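/- **Conventions.** A Riesz space is a real vector lattice; it is Dedekind complete if every nonempty subset that is bounded above has a supremum. An element $e\ge 0$ of a Riesz space $E$ is a weak order unit if $|x|\wedge e=0$ implies $x=0$. A component of $e$ is an element $p$ with $0\le p\le e$ and $(e-p)\wedge p=0$; the set of components of $e$ in $E$ is denoted $C_E(e)$. For Archimedean Riesz spaces $E$ and $F$, $E\,\overline{\otimes}\,F$ denotes their Fremlin tensor product, that is, the Archimedean Riesz space, unique up to isomorphism, with a Riesz bimorphism $(x,y)\mapsto x\otimes y$ from $E\times F$ through which every Riesz bimorphism from $E\times F$ to an Archimedean Riesz space factors by a unique Riesz homomorphism. Its Dedekind completion is denoted $\overline{E\,\overline{\otimes}\,F}^{\,\delta}$, and $x\otimes y$ is also regarded as an element of it. **Theorem 3.1.** Let $E$ and $F$ be Dedekind complete Riesz spaces with weak order units $e$ and $f$ respectively. (a) If $p\in C_E(e)$ and $q\in C_F(f)$, then $p\otimes q$ is a component of $e\otimes f$ in $\overline{E\,\overline{\otimes}\,F}^{\,\delta}$. (b) If $u$ is a component of $e\otimes f$ in $\overline{E\,\overline{\otimes}\,F}^{\,\delta}$, then $$u=\sup\{\,p\otimes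 q \;:\; p\in C_E(e),\ q\in C_F(f),\ p\otimes q\le u\,\},$$ where the supremum is taken in $\overline{E\,\overline{\otimes}\,F}^{\,\delta}$. -/

import Mathlib

/-!
A Riesz space (real vector lattice) is a type `E` with Mathlib's structures
`[AddCommGroup E] [Module ℝ E] [Lattice E] [IsOrderedAddMonoid E] [IsOrderedModule ℝ E]`.
-/

universe u v w

set_option linter.unusedSectionVars false

/-! ### Basic notions in Riesz spaces -/

/-- Every nonempty set that is bounded above has a supremum. -/
def IsDedekindComplete (E : Type u) [Lattice E] : Prop :=
  ∀ S : Set E, S.Nonempty → BddAbove S → ∃ a, IsLUB S a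

/-- Archimedean Riesz spaces: if `n x ≤ y` for every natural number `n`, then `x ≤ 0`.
(Mathlib's `Archimedean` is a stronger property, which forces every strictly positive element to
be a strong unit.) -/
class IsArchimedeanRiesz (E : Type u) [AddCommGroup E] [Lattice E] : Prop where
  nonpos_of_nsmul_le : ∀ x y : E, (∀ n : ℕ, n • x ≤ y) → x ≤ 0

/-- `e` is a weak order unit: `e ≥ 0`, and only `0` is disjoint from `e`. -/
def IsWeakOrderUnit {E : Type u} [AddCommGroup E] [Lattice E] (e : E) : Prop :=
  0 ≤ e ∧ ∀ x : E, |x| ⊓ e = 0 → x = 0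

/-- `p` is a component of `e`: `0 ≤ p ≤ e` and `(e - p) ∧ p = 0`. -/
def IsComponent {E : Type u} [AddCommGroup E] [Lattice E] (e p : E) : Prop :=
  0 ≤ p ∧ p ≤ e ∧ (e - p) ⊓ p = 0

/-- Riesz homomorphisms: linear maps that preserve the lattice operations. -/
structure RieszHom (G : Type u) (H : Type v)
    [AddCommGroup G] [Module ℝ G] [Lattice G] [AddCommGroup H] [Module ℝ H] [Lattice H]
    extends G →ₗ[ℝ] H where
  map_sup' : ∀ x y : G, toFun (x ⊔ y) = toFun x ⊔ toFun y
  map_inf' : ∀ x y : G, toFun (x ⊓ y) = toFun x ⊓ toFun y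

/-- Riesz bimorphisms `E × F → H`: bilinear maps `ψ` such that `ψ(·, y)` is a Riesz homomorphism
for every `y ≥ 0` and `ψ(x, ·)` is a Riesz homomorphism for every `x ≥ 0`. -/
structure RieszBimorphism (E : Type u) (F : Type v) (H : Type w)
    [AddCommGroup E] [Module ℝ E] [Lattice E] [AddCommGroup F] [Module ℝ F] [Lattice F]
    [AddCommGroup H] [Module ℝ H] [Lattice H] where
  toLin : E →ₗ[ℝ] F →ₗ[ℝ] H
  map_sup_left : ∀ (x x' : E) (y : F), 0 ≤ y → toLin (x ⊔ x') y = toLin x y ⊔ toLin x' y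
  map_inf_left : ∀ (x x' : E) (y : F), 0 ≤ y → toLin (x ⊓ x') y = toLin x y ⊓ toLin x' y
  map_sup_right : ∀ (x : E) (y y' : F), 0 ≤ x → toLin x (y ⊔ y') = toLin x y ⊔ toLin x y'
  map_inf_right : ∀ (x : E) (y y' : F), 0 ≤ x → toLin x (y ⊓ y') = toLin x y ⊓ toLin x y'

theorem IsDedekindComplete.isArchimedeanRiesz {E : Type u} [AddCommGroup E] [Lattice E]
    [IsOrderedAddMonoid E] (hE : IsDedekindComplete E) : IsArchimedeanRiesz E where
  nonpos_of_nsmul_le := by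
    intro x y h
    obtain ⟨a, ha⟩ := hE (Set.range fun n : ℕ => n • x) ⟨_, 0, rfl⟩
      ⟨y, by rintro _ ⟨n, rfl⟩; exact h n⟩
    have h1 : a ≤ a - x := ha.2 (by
      rintro _ ⟨n, rfl⟩
      have h2 : (n + 1) • x ≤ a := ha.1 ⟨n + 1, rfl⟩
      rw [succ_nsmul] at h2
      exact le_sub_iff_add_le.mpr h2)
    simpa using h1

/-! ### The Fremlin tensor product

The Fremlin tensor product of `E` and `F` is the Archimedean Riesz space, unique up to
isomorphism, that carries a universal Riesz bimorphism from `E × F` to Archimedean Riesz spaces.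
It is built as the space of all formal vector lattice expressions in the symbols `x ⊗ y`, where two
expressions are identified when they have the same value under every Riesz bimorphism from `E × F`
to an Archimedean Riesz space. -/

/-- Formal vector lattice expressions in the symbols `x ⊗ y`. -/
inductive LatticeExpr (E : Type u) (F : Type v) : Type (max u v)
  | tmul (x : E) (y : F) : LatticeExpr E F
  | zero : LatticeExpr E F
  | add (s t : LatticeExpr E F) : LatticeExpr E F
  | neg (t : LatticeExpr E F) : LatticeExpr E F
  | smul (r : ℝ) (t : LatticeExpr E F) : LatticeExpr E F
  | sup (s t : LatticeExpr E F) : LatticeExpr E F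
  | inf (s t : LatticeExpr E F) : LatticeExpr E F

/-- An Archimedean Riesz space together with a Riesz bimorphism from `E × F` to it. -/
structure BimorphismTarget (E : Type u) (F : Type v)
    [AddCommGroup E] [Module ℝ E] [Lattice E] [AddCommGroup F] [Module ℝ F] [Lattice F] where
  carrier : Type w
  [addCommGroup : AddCommGroup carrier]
  [module : Module ℝ carrier]
  [lattice : Lattice carrier]
  [isOrderedAddMonoid : IsOrderedAddMonoid carrier]
  [isOrderedModule : IsOrderedModule ℝ carrier]
  [isArchimedeanRiesz : IsArchimedeanRiesz carrier]
  bimorphism : RieszBimorphism E F carrier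

attribute [instance] BimorphismTarget.addCommGroup BimorphismTarget.module
  BimorphismTarget.lattice BimorphismTarget.isOrderedAddMonoid BimorphismTarget.isOrderedModule
  BimorphismTarget.isArchimedeanRiesz

section Tensor

variable {E : Type u} {F : Type v}
  [AddCommGroup E] [Module ℝ E] [Lattice E] [AddCommGroup F] [Module ℝ F] [Lattice F]

/-- The value of an expression under a Riesz bimorphism. -/
def LatticeExpr.eval {H : Type w} [AddCommGroup H] [Module ℝ H] [Lattice H]
    (ψ : RieszBimorphism E F H) : LatticeExpr E F → H
  | .tmul x y => ψ.toLin x y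
  | .zero => 0
  | .add s t => s.eval ψ + t.eval ψ
  | .neg t => - t.eval ψ
  | .smul r t => r • t.eval ψ
  | .sup s t => s.eval ψ ⊔ t.eval ψ
  | .inf s t => s.eval ψ ⊓ t.eval ψ

/-- Two expressions are equivalent when they have the same value at every target in `S`. -/
def exprSetoid (S : Set (BimorphismTarget.{u, v, w} E F)) : Setoid (LatticeExpr E F) where
  r s t := ∀ τ ∈ S, s.eval τ.bimorphism = t.eval τ.bimorphism
  iseqv := ⟨fun _ _ _ => rfl, fun h τ hτ => (h τ hτ).symm,
    fun h h' τ hτ => (h τ hτ).trans (h' τ hτ)⟩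

/-- Expressions modulo equality of values at all targets in `S`. -/
def ExprQuotient (S : Set (BimorphismTarget.{u, v, w} E F)) : Type (max u v) :=
  Quotient (exprSetoid S)

namespace ExprQuotient

variable {S : Set (BimorphismTarget.{u, v, w} E F)}

/-- The class of an expression. -/
def mk (t : LatticeExpr E F) : ExprQuotient S := Quotient.mk (exprSetoid S) t

theorem ind {P : ExprQuotient S → Prop} (h : ∀ t, P (mk t)) (a : ExprQuotient S) : P a :=
  Quotient.ind h a

/-- The value of a class at a target in `S`. -/
def eval (τ : BimorphismTarget.{u, v, w} E F) (hτ : τ ∈ S) (a : ExprQuotient S) : τ.carrier :=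
  Quotient.lift (fun t => t.eval τ.bimorphism)
    (fun s t (h : exprSetoid S s t) => h τ hτ) a

theorem ext {a b : ExprQuotient S} (h : ∀ τ hτ, eval τ hτ a = eval τ hτ b) : a = b := by
  induction a using ind
  induction b using ind
  exact Quotient.sound h

instance : Zero (ExprQuotient S) := ⟨mk .zero⟩

instance : Add (ExprQuotient S) := ⟨Quotient.map₂ .add fun _ _ h _ _ h' τ hτ => by
  simp only [LatticeExpr.eval, h τ hτ, h' τ hτ]⟩

instance : Neg (ExprQuotient S) := ⟨Quotient.map .neg fun _ _ h τ hτ => by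
  simp only [LatticeExpr.eval, h τ hτ]⟩

instance : SMul ℝ (ExprQuotient S) := ⟨fun r => Quotient.map (.smul r) fun _ _ h τ hτ => by
  simp only [LatticeExpr.eval, h τ hτ]⟩

/-- The lattice operation `⊔` on classes. -/
def sup : ExprQuotient S → ExprQuotient S → ExprQuotient S :=
  Quotient.map₂ .sup fun _ _ h _ _ h' τ hτ => by simp only [LatticeExpr.eval, h τ hτ, h' τ hτ]

/-- The lattice operation `⊓` on classes. -/
def inf : ExprQuotient S → ExprQuotient S → ExprQuotient S :=
  Quotient.map₂ .inf fun _ _ h _ _ h' τ hτ => by simp only [LatticeExpr.eval, h τ hτ, h' τ hτ]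

/-- `a ≤ b` means that the values are so ordered at every target in `S`. -/
instance : LE (ExprQuotient S) := ⟨fun a b => ∀ τ hτ, eval τ hτ a ≤ eval τ hτ b⟩

/-- The class of the symbol `x ⊗ y`. -/
def tmul (x : E) (y : F) : ExprQuotient S := mk (.tmul x y)

section eval

variable (τ : BimorphismTarget.{u, v, w} E F) (hτ : τ ∈ S) (a b : ExprQuotient S)

theorem le_def {a b : ExprQuotient S} : a ≤ b ↔ ∀ τ hτ, eval τ hτ a ≤ eval τ hτ b := Iff.rfl

@[simp] theorem eval_mk (t : LatticeExpr E F) :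
    eval τ hτ (mk t : ExprQuotient S) = t.eval τ.bimorphism := rfl

@[simp] theorem eval_tmul (x : E) (y : F) :
    eval τ hτ (tmul x y : ExprQuotient S) = τ.bimorphism.toLin x y := rfl

@[simp] theorem eval_zero : eval τ hτ (0 : ExprQuotient S) = 0 := rfl

@[simp] theorem eval_add : eval τ hτ (a + b) = eval τ hτ a + eval τ hτ b := by
  induction a using ind
  induction b using ind
  rfl

@[simp] theorem eval_neg : eval τ hτ (-a) = -eval τ hτ a := by
  induction a using ind
  rfl

@[simp] theorem eval_smul (r : ℝ) : eval τ hτ (r • a) = r • eval τ hτ a := by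
  induction a using ind
  rfl

theorem eval_sup_aux : eval τ hτ (ExprQuotient.sup a b) = eval τ hτ a ⊔ eval τ hτ b := by
  induction a using ind
  induction b using ind
  rfl

theorem eval_inf_aux : eval τ hτ (ExprQuotient.inf a b) = eval τ hτ a ⊓ eval τ hτ b := by
  induction a using ind
  induction b using ind
  rfl

end eval

instance : AddCommGroup (ExprQuotient S) where
  add_assoc a b c := ext fun τ hτ => by simp [add_assoc]
  zero_add a := ext fun τ hτ => by simp
  add_zero a := ext fun τ hτ => by simp
  nsmul := nsmulRec
  zsmul := zsmulRec
  neg_add_cancel a := ext fun τ hτ => by simp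
  add_comm a b := ext fun τ hτ => by simp [add_comm]

instance : Module ℝ (ExprQuotient S) where
  one_smul a := ext fun τ hτ => by simp
  mul_smul r s a := ext fun τ hτ => by simp [mul_smul]
  smul_zero r := ext fun τ hτ => by simp
  smul_add r a b := ext fun τ hτ => by simp
  add_smul r s a := ext fun τ hτ => by simp [add_smul]
  zero_smul a := ext fun τ hτ => by simp

instance : Lattice (ExprQuotient S) where
  le_refl a τ hτ := le_rfl
  le_trans a b c h h' τ hτ := (h τ hτ).trans (h' τ hτ)
  le_antisymm a b h h' := ext fun τ hτ => le_antisymm (h τ hτ) (h' τ hτ)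
  sup := ExprQuotient.sup
  le_sup_left a b τ hτ := by simp [eval_sup_aux]
  le_sup_right a b τ hτ := by simp [eval_sup_aux]
  sup_le a b c h h' τ hτ := by
    simpa [eval_sup_aux] using ⟨h τ hτ, h' τ hτ⟩
  inf := ExprQuotient.inf
  inf_le_left a b τ hτ := by simp [eval_inf_aux]
  inf_le_right a b τ hτ := by simp [eval_inf_aux]
  le_inf a b c h h' τ hτ := by
    simpa [eval_inf_aux] using ⟨h τ hτ, h' τ hτ⟩

@[simp] theorem eval_sup (τ : BimorphismTarget.{u, v, w} E F) (hτ : τ ∈ S) (a b : ExprQuotient S) :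
    eval τ hτ (a ⊔ b) = eval τ hτ a ⊔ eval τ hτ b := eval_sup_aux τ hτ a b

@[simp] theorem eval_inf (τ : BimorphismTarget.{u, v, w} E F) (hτ : τ ∈ S) (a b : ExprQuotient S) :
    eval τ hτ (a ⊓ b) = eval τ hτ a ⊓ eval τ hτ b := eval_inf_aux τ hτ a b

instance : IsOrderedAddMonoid (ExprQuotient S) where
  add_le_add_left a b h c τ hτ := by simpa using h τ hτ

instance : IsOrderedModule ℝ (ExprQuotient S) where
  smul_le_smul_of_nonneg_left r hr a b h τ hτ := by
    simpa using smul_le_smul_of_nonneg_left (h τ hτ) hr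
  smul_le_smul_of_nonneg_right a ha r s h τ hτ := by
    simpa using smul_le_smul_of_nonneg_right h (by simpa using ha τ hτ)

@[simp] theorem eval_nsmul (τ : BimorphismTarget.{u, v, w} E F) (hτ : τ ∈ S) (n : ℕ)
    (a : ExprQuotient S) : eval τ hτ (n • a) = n • eval τ hτ a := by
  induction n with
  | zero => simp
  | succ n ih => simp [succ_nsmul, ih]

instance : IsArchimedeanRiesz (ExprQuotient S) where
  nonpos_of_nsmul_le a b h τ hτ :=
    IsArchimedeanRiesz.nonpos_of_nsmul_le _ (eval τ hτ b) fun n => by simpa using h n τ hτ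

/-- The canonical Riesz bimorphism `(x, y) ↦ x ⊗ y`. -/
def bimorphism (S : Set (BimorphismTarget.{u, v, w} E F)) :
    RieszBimorphism E F (ExprQuotient S) where
  toLin := LinearMap.mk₂ ℝ tmul
    (fun x x' y => ext fun τ hτ => by simp) (fun r x y => ext fun τ hτ => by simp)
    (fun x y y' => ext fun τ hτ => by simp) (fun r x y => ext fun τ hτ => by simp)
  map_sup_left x x' y hy := ext fun τ hτ => by simp [τ.bimorphism.map_sup_left x x' y hy]
  map_inf_left x x' y hy := ext fun τ hτ => by simp [τ.bimorphism.map_inf_left x x' y hy]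
  map_sup_right x y y' hx := ext fun τ hτ => by simp [τ.bimorphism.map_sup_right x y y' hx]
  map_inf_right x y y' hx := ext fun τ hτ => by simp [τ.bimorphism.map_inf_right x y y' hx]

theorem eval_bimorphism (t : LatticeExpr E F) : t.eval (bimorphism S) = mk t := by
  induction t with
  | tmul x y => rfl
  | zero => rfl
  | add s t hs ht => simp only [LatticeExpr.eval, hs, ht]; rfl
  | neg t ht => simp only [LatticeExpr.eval, ht]; rfl
  | smul r t ht => simp only [LatticeExpr.eval, ht]; rfl
  | sup s t hs ht => simp only [LatticeExpr.eval, hs, ht]; rfl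
  | inf s t hs ht => simp only [LatticeExpr.eval, hs, ht]; rfl

/-- `ExprQuotient S` with its canonical bimorphism, as a target. -/
def target (S : Set (BimorphismTarget.{u, v, w} E F)) :
    BimorphismTarget.{u, v, max u v} E F where
  carrier := ExprQuotient S
  bimorphism := bimorphism S

end ExprQuotient

variable (E F) in
/-- The Fremlin tensor product of `E` and `F`. -/
abbrev FremlinTensor : Type (max u v) :=
  ExprQuotient (Set.univ : Set (BimorphismTarget.{u, v, max u v} E F))

namespace FremlinTensor

/-- Expressions that agree in the Fremlin tensor product have the same value under every Riesz
bimorphism to an Archimedean Riesz space, in whatever universe that space lives. -/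
theorem eval_eq_of_mk_eq (τ : BimorphismTarget.{u, v, w} E F) {s t : LatticeExpr E F}
    (h : (ExprQuotient.mk s : FremlinTensor E F) = ExprQuotient.mk t) :
    s.eval τ.bimorphism = t.eval τ.bimorphism := by
  have h1 := Quotient.exact h (ExprQuotient.target {τ}) (Set.mem_univ _)
  have h2 : (ExprQuotient.mk s : ExprQuotient {τ}) = ExprQuotient.mk t := by
    rw [← ExprQuotient.eval_bimorphism, ← ExprQuotient.eval_bimorphism]
    exact h1
  exact Quotient.exact h2 τ rfl

/-- The Riesz homomorphism induced by a Riesz bimorphism to an Archimedean Riesz space. -/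
def lift {H : Type w} [AddCommGroup H] [Module ℝ H] [Lattice H] [IsOrderedAddMonoid H]
    [IsOrderedModule ℝ H] [IsArchimedeanRiesz H] (ψ : RieszBimorphism E F H) :
    RieszHom (FremlinTensor E F) H where
  toFun := Quotient.lift (fun t => t.eval ψ) fun s t h =>
    eval_eq_of_mk_eq ⟨H, ψ⟩ (Quotient.sound h)
  map_add' a b := by
    induction a using ExprQuotient.ind
    induction b using ExprQuotient.ind
    rfl
  map_smul' r a := by
    induction a using ExprQuotient.ind
    rfl
  map_sup' a b := by
    induction a using ExprQuotient.ind
    induction b using ExprQuotient.ind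
    rfl
  map_inf' a b := by
    induction a using ExprQuotient.ind
    induction b using ExprQuotient.ind
    rfl

/-- The universal property of the Fremlin tensor product. -/
theorem existsUnique_lift {H : Type w} [AddCommGroup H] [Module ℝ H] [Lattice H]
    [IsOrderedAddMonoid H] [IsOrderedModule ℝ H] [IsArchimedeanRiesz H]
    (ψ : RieszBimorphism E F H) :
    ∃! T : RieszHom (FremlinTensor E F) H,
      ∀ x y, T.toLinearMap (ExprQuotient.tmul x y) = ψ.toLin x y := by
  refine ⟨lift ψ, fun x y => rfl, fun T hT => ?_⟩
  have key : ∀ t : LatticeExpr E F, T.toLinearMap (ExprQuotient.mk t) = t.eval ψ := by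
    intro t
    induction t with
    | tmul x y => exact hT x y
    | zero => exact T.map_zero
    | add s t hs ht => exact (T.map_add _ _).trans (congrArg₂ _ hs ht)
    | neg t ht => exact (T.map_neg _).trans (congrArg _ ht)
    | smul r t ht => exact (T.map_smul r _).trans (congrArg _ ht)
    | sup s t hs ht => exact (T.map_sup' _ _).trans (congrArg₂ _ hs ht)
    | inf s t hs ht => exact (T.map_inf' _ _).trans (congrArg₂ _ hs ht)
  have h2 : T.toLinearMap = (lift ψ).toLinearMap :=
    
    LinearMap.ext fun a => ExprQuotient.ind (P := fun a => T.toLinearMap a = _) key a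
  cases T
  cases h : lift ψ
  rw [h] at h2
  cases h2
  rfl

end FremlinTensor

end Tensor

/-! ### The Dedekind completion

The Dedekind completion of an Archimedean Riesz space consists of the Dedekind cuts with nonempty
left and right sets. -/

/-- The Dedekind completion of `G`: cuts `(L, R)` with `L`, `R` nonempty, `R` the set of upper
bounds of `L` and `L` the set of lower bounds of `R`, ordered by inclusion of the left sets. -/
def DedekindCompletion (G : Type u) [Lattice G] : Type u :=
  {A : DedekindCut G // A.left.Nonempty ∧ A.right.Nonempty}

namespace DedekindCompletion

section Order

variable {G : Type u} [Lattice G]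

/-- The left set of a cut. -/
def left (A : DedekindCompletion G) : Set G := A.1.left

/-- The right set of a cut. -/
def right (A : DedekindCompletion G) : Set G := A.1.right

theorem left_nonempty (A : DedekindCompletion G) : A.left.Nonempty := A.2.1

theorem right_nonempty (A : DedekindCompletion G) : A.right.Nonempty := A.2.2

theorem mem_right {A : DedekindCompletion G} {x : G} : x ∈ A.right ↔ ∀ a ∈ A.left, a ≤ x := by
  rw [right, ← DedekindCut.upperBounds_left]; rfl

theorem mem_left {A : DedekindCompletion G} {x : G} : x ∈ A.left ↔ ∀ b ∈ A.right, x ≤ b := by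
  rw [left, ← DedekindCut.lowerBounds_right]; rfl

theorem ext_right {A B : DedekindCompletion G} (h : ∀ x, x ∈ A.right ↔ x ∈ B.right) : A = B :=
  Subtype.ext (DedekindCut.ext' (Set.ext h))

instance : Lattice (DedekindCompletion G) :=
  Subtype.lattice
    (fun {A B} hA hB => ⟨hA.1.mono (Concept.extent_subset_extent_iff.mpr le_sup_left), by
      obtain ⟨a, ha⟩ := hA.2
      obtain ⟨b, hb⟩ := hB.2
      exact ⟨a ⊔ b, DedekindCut.le_principal_iff.mp (sup_le
        ((DedekindCut.le_principal_iff.mpr ha).trans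
          (DedekindCut.principal_le_principal.mpr le_sup_left))
        ((DedekindCut.le_principal_iff.mpr hb).trans
          (DedekindCut.principal_le_principal.mpr le_sup_right)))⟩⟩)
    (fun {A B} hA hB => ⟨by
      obtain ⟨a, ha⟩ := hA.1
      obtain ⟨b, hb⟩ := hB.1
      exact ⟨a ⊓ b, DedekindCut.principal_le_iff.mp (le_inf
        ((DedekindCut.principal_le_principal.mpr inf_le_left).trans
          (DedekindCut.principal_le_iff.mpr ha))
        ((DedekindCut.principal_le_principal.mpr inf_le_right).trans
          (DedekindCut.principal_le_iff.mpr hb)))⟩,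
      hA.2.mono (Concept.intent_subset_intent_iff.mpr inf_le_left)⟩)

theorem le_iff_left {A B : DedekindCompletion G} : A ≤ B ↔ A.left ⊆ B.left :=
  Concept.extent_subset_extent_iff.symm

theorem le_iff_right {A B : DedekindCompletion G} : A ≤ B ↔ B.right ⊆ A.right :=
  Concept.intent_subset_intent_iff.symm

/-- The cut generated by a nonempty set `T` that is bounded above: the right set consists of the
upper bounds of `T`. -/
def ofSet (T : Set G) (h : T.Nonempty) (h' : BddAbove T) : DedekindCompletion G :=
  ⟨{ extent := lowerBounds (upperBounds T)
     intent := upperBounds T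
     upperPolar_extent := by
       change upperBounds (lowerBounds (upperBounds T)) = upperBounds T
       exact Set.Subset.antisymm (upperBounds_mono_set (subset_lowerBounds_upperBounds T))
         (subset_upperBounds_lowerBounds _)
     lowerPolar_intent := rfl },
   h.mono (subset_lowerBounds_upperBounds T), h'⟩

theorem mem_ofSet_right {T : Set G} {h h'} {x : G} :
    x ∈ (ofSet T h h').right ↔ ∀ t ∈ T, t ≤ x := Iff.rfl

/-- The canonical embedding `g ↦ (Iic g, Ici g)`. -/
def of (g : G) : DedekindCompletion G :=
  ⟨DedekindCut.principal g, ⟨g, le_rfl⟩, ⟨g, le_rfl⟩⟩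

theorem mem_of_right {g x : G} : x ∈ (of g).right ↔ g ≤ x := Iff.rfl

theorem mem_of_left {g x : G} : x ∈ (of g).left ↔ x ≤ g := Iff.rfl

@[simp] theorem of_le_of {g h : G} : of g ≤ of h ↔ g ≤ h :=
  DedekindCut.principal_le_principal

theorem of_le_iff {g : G} {A : DedekindCompletion G} : of g ≤ A ↔ g ∈ A.left :=
  DedekindCut.principal_le_iff

theorem le_of_iff {g : G} {A : DedekindCompletion G} : A ≤ of g ↔ g ∈ A.right :=
  DedekindCut.le_principal_iff

theorem of_injective : Function.Injective (of : G → DedekindCompletion G) := fun _ _ h =>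
  le_antisymm (of_le_of.mp h.le) (of_le_of.mp h.ge)

theorem isDedekindComplete : IsDedekindComplete (DedekindCompletion G) := by
  rintro S ⟨A, hA⟩ ⟨B, hB⟩
  have hub : ∀ {x}, x ∈ B.right → x ∈ upperBounds (⋃ C ∈ S, C.left) := by
    intro x hx c hc
    simp only [Set.mem_iUnion] at hc
    obtain ⟨C, hC, hc⟩ := hc
    exact mem_right.mp (le_iff_right.mp (hB hC) hx) c hc
  refine ⟨ofSet (⋃ C ∈ S, C.left) ?_ ?_, ?_, ?_⟩
  · obtain ⟨a, ha⟩ := A.left_nonempty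
    exact ⟨a, by simp only [Set.mem_iUnion]; exact ⟨A, hA, ha⟩⟩
  · obtain ⟨b, hb⟩ := B.right_nonempty
    exact ⟨b, hub hb⟩
  · intro C hC
    refine le_iff_right.mpr fun x hx => mem_right.mpr fun c hc => hx ?_
    simp only [Set.mem_iUnion]
    exact ⟨C, hC, hc⟩
  · intro D hD
    refine le_iff_right.mpr fun x hx c hc => ?_
    simp only [Set.mem_iUnion] at hc
    obtain ⟨C, hC, hc⟩ := hc
    exact mem_right.mp (le_iff_right.mp (hD hC) hx) c hc

/-- Every element is the supremum of the elements of `G` below it. -/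
theorem isLUB_of_le (A : DedekindCompletion G) : IsLUB {B | ∃ g, B = of g ∧ of g ≤ A} A := by
  refine ⟨?_, fun B hB => le_iff_left.mpr fun g hg => ?_⟩
  · rintro _ ⟨g, rfl, h⟩
    exact h
  · exact of_le_iff.mp (hB ⟨g, rfl, of_le_iff.mpr hg⟩)

/-- Every element is the infimum of the elements of `G` above it. -/
theorem isGLB_le_of (A : DedekindCompletion G) : IsGLB {B | ∃ g, B = of g ∧ A ≤ of g} A := by
  refine ⟨?_, fun B hB => le_iff_right.mpr fun g hg => ?_⟩
  · rintro _ ⟨g, rfl, h⟩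
    exact h
  · exact le_of_iff.mp (hB ⟨g, rfl, le_of_iff.mpr hg⟩)

end Order

section Group

variable {G : Type u} [AddCommGroup G] [Lattice G] [IsOrderedAddMonoid G]

instance : Zero (DedekindCompletion G) := ⟨of 0⟩

/-- `A + B` is the cut generated by the sums `a + b` with `a` in the left set of `A` and `b` in
the left set of `B`. -/
instance : Add (DedekindCompletion G) where
  add A B := ofSet (Set.image2 (· + ·) A.left B.left)
    (A.left_nonempty.image2 B.left_nonempty) (by
      obtain ⟨x, hx⟩ := A.right_nonempty
      obtain ⟨y, hy⟩ := B.right_nonempty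
      refine ⟨x + y, ?_⟩
      rintro _ ⟨a, ha, b, hb, rfl⟩
      exact add_le_add (mem_right.mp hx a ha) (mem_right.mp hy b hb))

/-- `-A` is the cut generated by the elements `-b` with `b` in the right set of `A`. -/
instance : Neg (DedekindCompletion G) where
  neg A := ofSet ((fun b => -b) '' A.right) (A.right_nonempty.image _) (by
    obtain ⟨a, ha⟩ := A.left_nonempty
    refine ⟨-a, ?_⟩
    rintro _ ⟨b, hb, rfl⟩
    exact neg_le_neg (mem_right.mp hb a ha))

theorem mem_zero_right {x : G} : x ∈ (0 : DedekindCompletion G).right ↔ 0 ≤ x := Iff.rfl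

theorem mem_add_right {A B : DedekindCompletion G} {x : G} :
    x ∈ (A + B).right ↔ ∀ a ∈ A.left, ∀ b ∈ B.left, a + b ≤ x := by
  constructor
  · intro h a ha b hb
    exact h ⟨a, ha, b, hb, rfl⟩
  · rintro h _ ⟨a, ha, b, hb, rfl⟩
    exact h a ha b hb

theorem mem_neg_right {A : DedekindCompletion G} {x : G} :
    x ∈ (-A).right ↔ -x ∈ A.left := by
  rw [mem_left]
  constructor
  · intro h b hb
    exact neg_le.mp (h ⟨b, hb, rfl⟩)
  · rintro h _ ⟨b, hb, rfl⟩
    exact neg_le.mp (h b hb)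

theorem add_le_iff {A B C : DedekindCompletion G} :
    A + B ≤ C ↔ ∀ a ∈ A.left, ∀ b ∈ B.left, a + b ∈ C.left := by
  rw [le_iff_right]
  constructor
  · intro h a ha b hb
    exact mem_left.mpr fun c hc => mem_add_right.mp (h hc) a ha b hb
  · intro h c hc
    exact mem_add_right.mpr fun a ha b hb => mem_left.mp (h a ha b hb) c hc

theorem add_mem_left {A B : DedekindCompletion G} {a b : G} (ha : a ∈ A.left) (hb : b ∈ B.left) :
    a + b ∈ (A + B).left := add_le_iff.mp le_rfl a ha b hb

protected theorem add_comm' (A B : DedekindCompletion G) : A + B = B + A := by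
  refine ext_right fun x => ?_
  simp only [mem_add_right]
  exact ⟨fun h b hb a ha => add_comm a b ▸ h a ha b hb,
    fun h a ha b hb => add_comm b a ▸ h b hb a ha⟩

theorem mem_add_add_right {A B C : DedekindCompletion G} {x : G} :
    x ∈ (A + B + C).right ↔ ∀ a ∈ A.left, ∀ b ∈ B.left, ∀ c ∈ C.left, a + b + c ≤ x := by
  rw [mem_add_right]
  constructor
  · intro h a ha b hb c hc
    exact h _ (add_mem_left ha hb) c hc
  · intro h d hd c hc
    have : x - c ∈ (A + B).right :=
      mem_add_right.mpr fun a ha b hb => le_sub_iff_add_le.mpr (h a ha b hb c hc)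
    exact le_sub_iff_add_le.mp (mem_left.mp hd _ this)

protected theorem add_assoc' (A B C : DedekindCompletion G) : A + B + C = A + (B + C) := by
  refine ext_right fun x => ?_
  rw [DedekindCompletion.add_comm' A (B + C), mem_add_add_right, mem_add_add_right]
  constructor
  · intro h b hb c hc a ha
    have := h a ha b hb c hc
    rwa [add_assoc, add_comm] at this
  · intro h a ha b hb c hc
    have := h b hb c hc a ha
    rwa [add_comm, ← add_assoc] at this

protected theorem zero_add' (A : DedekindCompletion G) : 0 + A = A := by
  refine ext_right fun x => ?_
  rw [mem_add_right, mem_right]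
  constructor
  · intro h a ha
    simpa using h 0 (le_refl (0 : G)) a ha
  · intro h z hz a ha
    have hz' : z ≤ 0 := hz
    exact (add_le_of_nonpos_left hz').trans (h a ha)

variable [IsArchimedeanRiesz G]

protected theorem neg_add_cancel' (A : DedekindCompletion G) : -A + A = 0 := by
  rw [DedekindCompletion.add_comm']
  refine ext_right fun x => ?_
  rw [mem_add_right, mem_zero_right]
  constructor
  · intro h
    have step : ∀ a ∈ A.left, a - x ∈ A.left := by
      intro a ha
      refine mem_left.mpr fun b hb => ?_
      have hb' : -b ∈ (-A).left :=
        mem_left.mpr fun y hy => neg_le.mp (mem_left.mp (mem_neg_right.mp hy) b hb)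
      have := h a ha (-b) hb'
      rw [sub_le_iff_le_add]
      rw [← sub_eq_add_neg, sub_le_iff_le_add] at this
      rwa [add_comm]
    obtain ⟨a, ha⟩ := A.left_nonempty
    obtain ⟨b, hb⟩ := A.right_nonempty
    have iter : ∀ n : ℕ, a - n • x ∈ A.left := by
      intro n
      induction n with
      | zero => simpa using ha
      | succ n ih => simpa [succ_nsmul, sub_sub] using step _ ih
    have := IsArchimedeanRiesz.nonpos_of_nsmul_le (-x) (b - a) fun n => by
      have h3 := mem_left.mp (iter n) b hb
      rw [smul_neg, le_sub_iff_add_le, add_comm, ← sub_eq_add_neg]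
      exact h3
    simpa using this
  · intro hx a ha c hc
    refine le_trans ?_ hx
    have : -a ∈ (-A).right := mem_neg_right.mpr (by simpa using ha)
    have := mem_left.mp hc _ this
    exact add_comm c a ▸ le_neg_iff_add_nonpos_right.mp this

instance : AddCommGroup (DedekindCompletion G) where
  add_assoc := DedekindCompletion.add_assoc'
  zero_add := DedekindCompletion.zero_add'
  add_zero A := by rw [DedekindCompletion.add_comm', DedekindCompletion.zero_add']
  nsmul := nsmulRec
  zsmul := zsmulRec
  neg_add_cancel := DedekindCompletion.neg_add_cancel'
  add_comm := DedekindCompletion.add_comm'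

instance : IsOrderedAddMonoid (DedekindCompletion G) where
  add_le_add_left _ _ h _ := add_le_iff.mpr fun _ ha _ hc =>
    add_mem_left (le_iff_left.mp h ha) hc

end Group

section Module

variable {G : Type u} [AddCommGroup G] [Module ℝ G] [Lattice G] [IsOrderedAddMonoid G]
  [IsOrderedModule ℝ G]

/-- For `r ≥ 0`, the cut `r A` is generated by the elements `r a` with `a` in the left set. -/
def scale (r : NNReal) (A : DedekindCompletion G) : DedekindCompletion G :=
  ofSet ((fun a => (r : ℝ) • a) '' A.left) (A.left_nonempty.image _) (by
    obtain ⟨b, hb⟩ := A.right_nonempty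
    refine ⟨(r : ℝ) • b, ?_⟩
    rintro _ ⟨a, ha, rfl⟩
    exact smul_le_smul_of_nonneg_left (mem_right.mp hb a ha) r.2)

theorem mem_scale_right {r : NNReal} {A : DedekindCompletion G} {x : G} :
    x ∈ (scale r A).right ↔ ∀ a ∈ A.left, (r : ℝ) • a ≤ x := by
  constructor
  · intro h a ha
    exact h ⟨a, ha, rfl⟩
  · rintro h _ ⟨a, ha, rfl⟩
    exact h a ha

theorem scale_le_iff {r : NNReal} {A C : DedekindCompletion G} :
    scale r A ≤ C ↔ ∀ a ∈ A.left, (r : ℝ) • a ∈ C.left := by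
  rw [le_iff_right]
  constructor
  · intro h a ha
    exact mem_left.mpr fun c hc => mem_scale_right.mp (h hc) a ha
  · intro h c hc
    exact mem_scale_right.mpr fun a ha => mem_left.mp (h a ha) c hc

theorem smul_mem_left {r : NNReal} {A : DedekindCompletion G} {a : G} (ha : a ∈ A.left) :
    (r : ℝ) • a ∈ (scale r A).left := scale_le_iff.mp le_rfl a ha

theorem scale_mono (r : NNReal) {A B : DedekindCompletion G} (h : A ≤ B) :
    scale r A ≤ scale r B :=
  scale_le_iff.mpr fun _ ha => smul_mem_left (le_iff_left.mp h ha)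

theorem scale_zero_left (A : DedekindCompletion G) : scale 0 A = 0 := by
  refine ext_right fun x => ?_
  rw [mem_scale_right, mem_zero_right]
  obtain ⟨a, ha⟩ := A.left_nonempty
  exact ⟨fun h => by simpa using h a ha, fun h b _ => by simpa using h⟩

theorem scale_one (A : DedekindCompletion G) : scale 1 A = A := by
  refine ext_right fun x => ?_
  rw [mem_scale_right, mem_right]
  simp

theorem scale_mul (r s : NNReal) (A : DedekindCompletion G) :
    scale (r * s) A = scale r (scale s A) := by
  rcases eq_or_ne r 0 with rfl | hr
  · rw [zero_mul, scale_zero_left, scale_zero_left]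
  have hr' : 0 < (r : ℝ) := by positivity
  refine le_antisymm (scale_le_iff.mpr fun a ha => ?_) (scale_le_iff.mpr fun b hb => ?_)
  · rw [NNReal.coe_mul, mul_smul]
    exact smul_mem_left (smul_mem_left ha)
  · refine mem_left.mpr fun c hc => ?_
    rw [← le_inv_smul_iff_of_pos hr']
    refine mem_left.mp hb _ (mem_scale_right.mpr fun a ha => ?_)
    rw [le_inv_smul_iff_of_pos hr', ← mul_smul]
    exact mem_scale_right.mp hc a ha

theorem scale_add_left (r s : NNReal) (A : DedekindCompletion G) :
    scale (r + s) A = scale r A + scale s A := by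
  refine ext_right fun x => ?_
  rw [mem_scale_right]
  constructor
  · intro h
    refine mem_add_right.mpr fun b hb c hc => ?_
    rw [← le_sub_iff_add_le]
    refine mem_left.mp hb _ (mem_scale_right.mpr fun a ha => ?_)
    rw [le_sub_comm]
    refine mem_left.mp hc _ (mem_scale_right.mpr fun a' ha' => ?_)
    rw [le_sub_iff_add_le, add_comm]
    have hm : a ⊔ a' ∈ A.left :=
      mem_left.mpr fun d hd => sup_le (mem_right.mp hd a ha) (mem_right.mp hd a' ha')
    refine le_trans ?_ (h _ hm)
    rw [NNReal.coe_add, add_smul]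
    exact add_le_add (smul_le_smul_of_nonneg_left le_sup_left r.2)
      (smul_le_smul_of_nonneg_left le_sup_right s.2)
  · intro h a ha
    rw [NNReal.coe_add, add_smul]
    exact mem_add_right.mp h _ (smul_mem_left ha) _ (smul_mem_left ha)

theorem scale_add (r : NNReal) (A B : DedekindCompletion G) :
    scale r (A + B) = scale r A + scale r B := by
  rcases eq_or_ne r 0 with rfl | hr
  · rw [scale_zero_left, scale_zero_left, scale_zero_left, DedekindCompletion.zero_add']
  have hr' : 0 < (r : ℝ) := by positivity
  refine le_antisymm (scale_le_iff.mpr fun c hc => mem_left.mpr fun x hx => ?_)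
    (add_le_iff.mpr fun b hb c hc => mem_left.mpr fun x hx => ?_)
  · rw [← le_inv_smul_iff_of_pos hr']
    refine mem_left.mp hc _ (mem_add_right.mpr fun a ha b hb => ?_)
    rw [le_inv_smul_iff_of_pos hr', smul_add]
    exact mem_add_right.mp hx _ (smul_mem_left ha) _ (smul_mem_left hb)
  · rw [← le_sub_iff_add_le]
    refine mem_left.mp hb _ (mem_scale_right.mpr fun a ha => ?_)
    rw [le_sub_comm]
    refine mem_left.mp hc _ (mem_scale_right.mpr fun a' ha' => ?_)
    rw [le_sub_iff_add_le, add_comm, ← smul_add]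
    exact mem_scale_right.mp hx _ (add_mem_left ha ha')

variable [IsArchimedeanRiesz G]

/-- Scalar multiplication: `r A = r⁺ A - r⁻ A`. -/
noncomputable instance : SMul ℝ (DedekindCompletion G) where
  smul r A := scale r.toNNReal A - scale (-r).toNNReal A

theorem smul_def (r : ℝ) (A : DedekindCompletion G) :
    r • A = scale r.toNNReal A - scale (-r).toNNReal A := rfl

theorem smul_of_nonneg {r : ℝ} (hr : 0 ≤ r) (A : DedekindCompletion G) :
    r • A = scale r.toNNReal A := by
  rw [smul_def, Real.toNNReal_of_nonpos (neg_nonpos.mpr hr), scale_zero_left, sub_zero]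

theorem smul_of_nonpos {r : ℝ} (hr : r ≤ 0) (A : DedekindCompletion G) :
    r • A = -scale (-r).toNNReal A := by
  rw [smul_def, Real.toNNReal_of_nonpos hr, scale_zero_left, zero_sub]

theorem scale_zero (r : NNReal) : scale r (0 : DedekindCompletion G) = 0 := by
  have h := scale_add r (0 : DedekindCompletion G) 0
  simpa using h

theorem scale_neg (r : NNReal) (A : DedekindCompletion G) : scale r (-A) = -scale r A := by
  rw [eq_neg_iff_add_eq_zero, ← scale_add, neg_add_cancel, scale_zero]

noncomputable instance : Module ℝ (DedekindCompletion G) where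
  one_smul A := by
    rw [smul_of_nonneg zero_le_one, Real.toNNReal_one, scale_one]
  mul_smul r s A := by
    rcases le_total 0 r with hr | hr <;> rcases le_total 0 s with hs | hs
    · rw [smul_of_nonneg (mul_nonneg hr hs), smul_of_nonneg hr, smul_of_nonneg hs,
        Real.toNNReal_mul hr, scale_mul]
    · rw [smul_of_nonpos (mul_nonpos_of_nonneg_of_nonpos hr hs), smul_of_nonneg hr,
        smul_of_nonpos hs, scale_neg, ← mul_neg, Real.toNNReal_mul hr, scale_mul]
    · rw [smul_of_nonpos (mul_nonpos_of_nonpos_of_nonneg hr hs), smul_of_nonpos hr,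
        smul_of_nonneg hs, ← neg_mul, Real.toNNReal_mul (neg_nonneg.mpr hr), scale_mul]
    · rw [smul_of_nonneg (mul_nonneg_of_nonpos_of_nonpos hr hs), smul_of_nonpos hr,
        smul_of_nonpos hs, scale_neg, neg_neg, ← neg_mul_neg,
        Real.toNNReal_mul (neg_nonneg.mpr hr), scale_mul]
  smul_zero r := by rw [smul_def, scale_zero, scale_zero, sub_zero]
  smul_add r A B := by
    simp only [smul_def, scale_add]
    abel
  add_smul r s A := by
    have key : (r + s).toNNReal + (-r).toNNReal + (-s).toNNReal
        = r.toNNReal + s.toNNReal + (-(r + s)).toNNReal := by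
      apply NNReal.coe_injective
      simp only [NNReal.coe_add, Real.coe_toNNReal']
      have h (t : ℝ) : max t 0 = t + max (-t) 0 := by
        rcases le_total 0 t with ht | ht <;> simp [ht]
      linarith [h r, h s, h (r + s)]
    have h := congrArg (fun t => scale t A) key
    simp only [scale_add_left] at h
    simp only [smul_def]
    rw [sub_add_sub_comm, sub_eq_sub_iff_add_eq_add, ← add_assoc]
    exact h
  zero_smul A := by rw [smul_of_nonneg le_rfl, Real.toNNReal_zero, scale_zero_left]

instance : IsOrderedModule ℝ (DedekindCompletion G) where
  smul_le_smul_of_nonneg_left r hr A B h := by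
    rw [smul_of_nonneg hr, smul_of_nonneg hr]
    exact scale_mono _ h
  smul_le_smul_of_nonneg_right A hA r s h := by
    rw [← sub_nonneg, ← sub_smul, smul_of_nonneg (sub_nonneg.mpr h)]
    have := scale_mono (s - r).toNNReal hA
    rwa [scale_zero] at this

/-- The canonical embedding of `G` in its Dedekind completion is a Riesz homomorphism. -/
def ofHom : RieszHom G (DedekindCompletion G) where
  toFun := of
  map_add' x y := by
    refine ext_right fun z => ?_
    rw [mem_add_right, mem_of_right]
    exact ⟨fun h a ha b hb => (add_le_add ha hb).trans h, fun h => h x le_rfl y le_rfl⟩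
  map_smul' r x := by
    have h0 (s : NNReal) (y : G) : scale s (of y) = of ((s : ℝ) • y) := by
      refine ext_right fun z => ?_
      rw [mem_scale_right, mem_of_right]
      exact ⟨fun h => h y le_rfl,
        fun h a ha => (smul_le_smul_of_nonneg_left ha s.2).trans h⟩
    have hneg (y : G) : of (-y) = -of y := by
      refine ext_right fun z => ?_
      rw [mem_neg_right, mem_of_right, mem_of_left, neg_le]
    rcases le_total 0 r with hr | hr
    · simp only [RingHom.id_apply]
      rw [smul_of_nonneg hr, h0, Real.coe_toNNReal r hr]
    · simp only [RingHom.id_apply]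
      rw [smul_of_nonpos hr, h0, Real.coe_toNNReal _ (neg_nonneg.mpr hr), ← hneg, neg_smul,
        neg_neg]
  map_sup' x y := by
    refine le_antisymm (le_iff_right.mpr fun z hz => mem_of_right.mpr ?_)
      (sup_le (of_le_of.mpr le_sup_left) (of_le_of.mpr le_sup_right))
    have h := le_of_iff.mpr hz
    exact sup_le (of_le_of.mp (le_sup_left.trans h)) (of_le_of.mp (le_sup_right.trans h))
  map_inf' x y := by
    refine le_antisymm (le_inf (of_le_of.mpr inf_le_left) (of_le_of.mpr inf_le_right))
      (le_iff_left.mpr fun z hz => mem_of_left.mpr ?_)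
    have h := of_le_iff.mpr hz
    exact le_inf (of_le_of.mp (h.trans inf_le_left)) (of_le_of.mp (h.trans inf_le_right))

end Module

end DedekindCompletion

/-! ### The Dedekind complete tensor product -/

section CompleteTensor

variable {E : Type u} {F : Type v}
  [AddCommGroup E] [Module ℝ E] [Lattice E] [AddCommGroup F] [Module ℝ F] [Lattice F]

variable (E F) in
/-- The Dedekind completion of the Fremlin tensor product of `E` and `F`. -/
abbrev DedekindTensor : Type (max u v) := DedekindCompletion (FremlinTensor E F)

/-- The elementary tensor `x ⊗ y` in the Dedekind completion of the Fremlin tensor product. -/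
def dtmul (x : E) (y : F) : DedekindTensor E F := DedekindCompletion.of (ExprQuotient.tmul x y)

end CompleteTensor

/-! ### Disjointness and local inequalities in Riesz spaces -/

section LocalOrder

variable {G : Type u} [AddCommGroup G] [Module ℝ G] [Lattice G] [IsOrderedAddMonoid G]
  [IsOrderedModule ℝ G]

/-! Assertion (a) is a computation: e⊗f − p⊗q = (e−p)⊗f + p⊗(f−q), and both summands are disjoint
from p⊗q (`RieszBimorphism.isComponent`).

For (b) it suffices, by `IsComponent.isLUB_of_dense`, that every A > 0 in the completion dominates a
positive multiple of a nonzero p⊗q. Indeed, if an upper bound B did not dominate u, such a multiple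
would lie below u − u∧B. A component with a positive multiple below u is itself below u, hence below
B, and is then disjoint from itself.

The density descends in steps (`exists_smul_dtmul_le`): from A to some g > 0 in the tensor product,
from g to a multiple of an elementary tensor h⊗k, and from h and k to multiples of components, as in
Freudenthal's spectral theorem.

The step from g to h⊗k (`FremlinTensor.exists_smul_tmul_le`) imitates continuity of functions on a
product. `ApproxOn` says that z is nearly a constant multiple of c on the band of h. This calculus
is stable under the vector lattice operations, and bisection (`exists_approxOn`) makes x and y
nearly constant on small parts h and k. So every lattice expression in elementary tensors is nearly
constant on small rectangles h⊗k, and where g > 0 has a positive constant it dominates a multiple of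
the rectangle.

That p⊗q is nonzero (`tmul_ne_zero`) needs one Archimedean target that detects it. Values at points
of E exist only for countably many elements at a time, so the target consists of germs of F-valued
functions along a countably complete filter of such point values. -/

theorem add_inf_le_of_nonneg {x y z : G} (hx : 0 ≤ x) (hy : 0 ≤ y) (hz : 0 ≤ z) :
    (x + y) ⊓ z ≤ x ⊓ z + y ⊓ z := by
  rw [add_inf, inf_add, inf_add]
  refine le_inf (le_inf inf_le_left ?_) (le_inf ?_ ?_)
  · exact inf_le_right.trans (le_add_of_nonneg_right hy)
  · exact inf_le_right.trans (le_add_of_nonneg_left hx)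
  · exact inf_le_right.trans (le_add_of_nonneg_left hz)

theorem inf_eq_zero_mono {x y x' y' : G} (hx' : 0 ≤ x') (hy' : 0 ≤ y') (hx : x' ≤ x)
    (hy : y' ≤ y) (h : x ⊓ y = 0) : x' ⊓ y' = 0 :=
  le_antisymm ((inf_le_inf hx hy).trans h.le) (le_inf hx' hy')

theorem add_inf_eq_zero {x y z : G} (hx : 0 ≤ x) (hy : 0 ≤ y) (hz : 0 ≤ z) (h : x ⊓ z = 0)
    (h' : y ⊓ z = 0) : (x + y) ⊓ z = 0 :=
  le_antisymm ((add_inf_le_of_nonneg hx hy hz).trans (by rw [h, h', add_zero]))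
    (le_inf (add_nonneg hx hy) hz)

theorem nsmul_inf_eq_zero {x z : G} (hx : 0 ≤ x) (hz : 0 ≤ z) (h : x ⊓ z = 0) (n : ℕ) :
    (n • x) ⊓ z = 0 := by
  induction n with
  | zero => simpa using hz
  | succ n ih => rw [succ_nsmul]; exact add_inf_eq_zero (nsmul_nonneg hx n) hx hz ih h

theorem smul_inf_eq_zero {x z : G} (hx : 0 ≤ x) (hz : 0 ≤ z) (h : x ⊓ z = 0) {r : ℝ}
    (hr : 0 ≤ r) : (r • x) ⊓ z = 0 := by
  obtain ⟨n, hn⟩ := exists_nat_ge r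
  refine inf_eq_zero_mono (smul_nonneg hr hx) hz ?_ le_rfl (nsmul_inf_eq_zero hx hz h n)
  rw [← Nat.cast_smul_eq_nsmul ℝ]
  exact smul_le_smul_of_nonneg_right hn hx

theorem posPart_le_of_nonneg {x y : G} (hxy : x ≤ y) (hy : 0 ≤ y) : x⁺ ≤ y := sup_le hxy hy

theorem posPart_add_le (x y : G) : (x + y)⁺ ≤ x⁺ + y⁺ :=
  sup_le (add_le_add (le_posPart x) (le_posPart y)) (add_nonneg (posPart_nonneg x) (posPart_nonneg y))

theorem posPart_smul_of_nonneg {r : ℝ} (hr : 0 ≤ r) (x : G) : (r • x)⁺ ≤ r • x⁺ :=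
  sup_le (smul_le_smul_of_nonneg_left (le_posPart x) hr) (smul_nonneg hr (posPart_nonneg x))

/-- `z ≤ 0` holds on the band generated by `h`. -/
def NonposOn (h z : G) : Prop := z⁺ ⊓ h = 0

theorem NonposOn.of_nonpos {h z : G} (hh : 0 ≤ h) (hz : z ≤ 0) : NonposOn h z := by
  rw [NonposOn, posPart_eq_zero.mpr hz]
  exact inf_eq_left.mpr hh

theorem NonposOn.mono {h z z' : G} (hh : 0 ≤ h) (H : NonposOn h z) (hz : z' ≤ z) :
    NonposOn h z' :=
  inf_eq_zero_mono (posPart_nonneg _) hh (posPart_mono hz) le_rfl H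

theorem NonposOn.anti {h h' z : G} (H : NonposOn h z) (hh' : 0 ≤ h') (hh : h' ≤ h) :
    NonposOn h' z :=
  inf_eq_zero_mono (posPart_nonneg _) hh' le_rfl hh H

theorem NonposOn.add {h z z' : G} (hh : 0 ≤ h) (H : NonposOn h z) (H' : NonposOn h z') :
    NonposOn h (z + z') :=
  inf_eq_zero_mono (posPart_nonneg _) hh (posPart_add_le z z') le_rfl
    (add_inf_eq_zero (posPart_nonneg _) (posPart_nonneg _) hh H H')

theorem NonposOn.smul {h z : G} (hh : 0 ≤ h) (H : NonposOn h z) {r : ℝ} (hr : 0 ≤ r) :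
    NonposOn h (r • z) :=
  inf_eq_zero_mono (posPart_nonneg _) hh (posPart_smul_of_nonneg hr z) le_rfl
    (smul_inf_eq_zero (posPart_nonneg _) hh H hr)

theorem NonposOn.sup {h z z' : G} (hh : 0 ≤ h) (H : NonposOn h z) (H' : NonposOn h z') :
    NonposOn h (z ⊔ z') := by
  refine inf_eq_zero_mono (posPart_nonneg _) hh (?_ : _ ≤ z⁺ + z'⁺) le_rfl
    (add_inf_eq_zero (posPart_nonneg _) (posPart_nonneg _) hh H H')
  refine posPart_le_of_nonneg (sup_le ?_ ?_) (add_nonneg (posPart_nonneg _) (posPart_nonneg _))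
  · exact (le_posPart z).trans (le_add_of_nonneg_right (posPart_nonneg _))
  · exact (le_posPart z').trans (le_add_of_nonneg_left (posPart_nonneg _))

/-- Here z⁺ lies in the ideal generated by h and is also disjoint from h, so it vanishes. This is
the passage from inequalities on a band back to inequalities in the whole space. -/
theorem NonposOn.nonpos {h z : G} (hh : 0 ≤ h) (H : NonposOn h z) {r : ℝ} (hr : 0 ≤ r)
    (hz : z ≤ r • h) : z ≤ 0 := by
  have h1 : z⁺ ≤ r • h := posPart_le_of_nonneg hz (smul_nonneg hr hh)
  have h2 : r • h ⊓ z⁺ = 0 := smul_inf_eq_zero hh (posPart_nonneg _) (by rw [inf_comm]; exact H) hr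
  rw [inf_eq_right.mpr h1] at h2
  exact posPart_eq_zero.mp h2

/-- The positive and negative parts of z are disjoint. This is how local inequalities are produced:
cutting h down to its meet with z⁺ forces z ≥ 0 there. -/
theorem NonposOn.posPart_neg (z : G) : NonposOn z⁺ (-z) := by
  rw [NonposOn, _root_.posPart_neg, inf_comm]
  exact posPart_inf_negPart_eq_zero z

/-- On the band generated by `h`, the element `z` differs from `r • c` by at most `ε • c`. -/
def ApproxOn (c h : G) (ε : ℝ) (z : G) (r : ℝ) : Prop :=
  NonposOn h (z - (r + ε) • c) ∧ NonposOn h ((r - ε) • c - z)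

namespace ApproxOn

variable {c h h' z z' : G} {ε ε' r s : ℝ}

theorem anti (H : ApproxOn c h ε z r) (hh' : 0 ≤ h') (hh : h' ≤ h) : ApproxOn c h' ε z r :=
  ⟨H.1.anti hh' hh, H.2.anti hh' hh⟩

theorem mono (hc : 0 ≤ c) (hh : 0 ≤ h) (H : ApproxOn c h ε z r) (hε : ε ≤ ε') :
    ApproxOn c h ε' z r := by
  have h1 := smul_nonneg (sub_nonneg.mpr hε) hc
  refine ⟨H.1.mono hh ?_, H.2.mono hh ?_⟩ <;> rw [← sub_nonneg]
  · convert h1 using 1; module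
  · convert h1 using 1; module

theorem add (hh : 0 ≤ h) (H : ApproxOn c h ε z r) (H' : ApproxOn c h ε' z' s) :
    ApproxOn c h (ε + ε') (z + z') (r + s) := by
  refine ⟨?_, ?_⟩
  · convert H.1.add hh H'.1 using 1; module
  · convert H.2.add hh H'.2 using 1; module

theorem neg (H : ApproxOn c h ε z r) : ApproxOn c h ε (-z) (-r) := by
  refine ⟨?_, ?_⟩
  · convert H.2 using 1; module
  · convert H.1 using 1; module

theorem smul (hh : 0 ≤ h) (H : ApproxOn c h ε z r) (t : ℝ) :
    ApproxOn c h (|t| * ε) (t • z) (t * r) := by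
  have key : ∀ {t : ℝ} {z : G} {r : ℝ}, 0 ≤ t → ApproxOn c h ε z r →
      ApproxOn c h (t * ε) (t • z) (t * r) := by
    intro t z r ht H
    refine ⟨?_, ?_⟩
    · convert H.1.smul hh ht using 1; module
    · convert H.2.smul hh ht using 1; module
  rcases le_total 0 t with ht | ht
  · rw [abs_of_nonneg ht]; exact key ht H
  · rw [abs_of_nonpos ht]
    simpa using key (neg_nonneg.mpr ht) H.neg

theorem sup (hc : 0 ≤ c) (hh : 0 ≤ h) (H : ApproxOn c h ε z r) (H' : ApproxOn c h ε z' s) :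
    ApproxOn c h ε (z ⊔ z') (r ⊔ s) := by
  refine ⟨?_, ?_⟩
  · refine (H.1.sup hh H'.1).mono hh ?_
    rw [sup_sub]
    refine sup_le_sup (sub_le_sub_left ?_ _) (sub_le_sub_left ?_ _) <;>
    refine smul_le_smul_of_nonneg_right ?_ hc
    · linarith [le_max_left r s]
    · linarith [le_max_right r s]
  · rcases le_total r s with h1 | h1
    · rw [sup_eq_right.mpr h1]
      exact H'.2.mono hh (sub_le_sub_left le_sup_right _)
    · rw [sup_eq_left.mpr h1]
      exact H.2.mono hh (sub_le_sub_left le_sup_left _)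

/-- Dual to the case of suprema, through z ↦ −z. -/
theorem inf (hc : 0 ≤ c) (hh : 0 ≤ h) (H : ApproxOn c h ε z r) (H' : ApproxOn c h ε z' s) :
    ApproxOn c h ε (z ⊓ z') (r ⊓ s) := by
  have := (H.neg.sup hc hh H'.neg).neg
  rwa [neg_sup, neg_neg, neg_neg, neg_sup, neg_neg, neg_neg] at this

theorem self_unit (hh : 0 ≤ h) : ApproxOn c h 0 c 1 :=
  ⟨.of_nonpos hh (by simp), .of_nonpos hh (by simp)⟩

theorem of_abs_le (hh : 0 ≤ h) {M : ℝ} (hz : |z| ≤ M • c) : ApproxOn c h M z 0 := by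
  obtain ⟨h1, h2⟩ := abs_le'.mp hz
  refine ⟨.of_nonpos hh ?_, .of_nonpos hh ?_⟩
  · simpa using h1
  · rw [zero_sub, neg_smul, sub_nonpos]
    exact neg_le.mp h2

/-- Approximate values are almost unique. -/
theorem abs_sub_le (hh : 0 < h) (hhc : h ≤ c) (H : ApproxOn c h ε z r)
    (H' : ApproxOn c h ε' z s) : |r - s| ≤ ε + ε' := by
  -- If t were positive, c ≤ 0 would hold on the band of h, and h ≤ c would then force the nonzero h
  -- to be nonpositive.
  have key : ∀ {t : ℝ}, NonposOn h (t • c) → t ≤ 0 := by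
    intro t ht
    by_contra! h0
    have h1 := (ht.smul hh.le (inv_nonneg.mpr h0.le))
    rw [smul_smul, inv_mul_cancel₀ h0.ne', one_smul] at h1
    exact hh.not_ge ((h1.mono hh.le hhc).nonpos hh.le zero_le_one (by rw [one_smul]))
  have h1 : NonposOn h (((r - ε) - (s + ε')) • c) := by
    convert H.2.add hh.le H'.1 using 1; module
  have h2 : NonposOn h (((s - ε') - (r + ε)) • c) := by
    convert H'.2.add hh.le H.1 using 1; module
  rw [abs_le]
  constructor <;> linarith [key h1, key h2]

end ApproxOn

/-- One step of the localization: on a part of `h` the error shrinks by a factor `2 / 3`. -/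
theorem exists_approxOn_step {N : G → Prop} (hmono : ∀ h h', 0 ≤ h' → h' ≤ h → N h → N h')
    (hadd : ∀ h h', 0 ≤ h → 0 ≤ h' → N h → N h' → N (h + h')) {c h x : G} (hh : 0 ≤ h) (hhc : h ≤ c)
    (hN : ¬ N h) {M r : ℝ} (hM : 0 < M) (hx : ApproxOn c h M x r) :
    ∃ h', 0 ≤ h' ∧ h' ≤ h ∧ ¬ N h' ∧ ∃ s, ApproxOn c h' (2 / 3 * M) x s := by
  -- The part under u is where x exceeds (r − M/3)c, the part under v where x is below (r + M/3)c.
  -- The two ranges overlap by 2M/3, so u + v dominates a positive multiple of c, and h cannot be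
  -- negligible on both parts. On either part the interval of length 2M shrinks to one of length
  -- 4M/3.
  set u := (x - (r - M / 3) • c)⁺ with hu
  set v := ((r + M / 3) • c - x)⁺ with hv
  have hu0 : 0 ≤ u := posPart_nonneg _
  have hv0 : 0 ≤ v := posPart_nonneg _
  have huv : (2 / 3 * M) • c ≤ u + v := by
    refine le_trans (le_of_eq ?_) (add_le_add (le_posPart _) (le_posPart _))
    module
  by_cases h1 : N (h ⊓ u)
  · by_cases h2 : N (h ⊓ v)
    · exfalso
      obtain ⟨n, hn⟩ := exists_nat_ge (2 / 3 * M)⁻¹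
      have hNn : ∀ {y : G}, 0 ≤ y → N y → ∀ n : ℕ, N ((n + 1) • y) := by
        intro y hy hNy n
        induction n with
        | zero => simpa using hNy
        | succ n ih =>
          rw [succ_nsmul]
          exact hadd _ _ (nsmul_nonneg hy _) hy ih hNy
      have hi : 0 ≤ h ⊓ (u + v) := le_inf hh (add_nonneg hu0 hv0)
      have h3 : N (h ⊓ (u + v)) := by
        refine hmono _ _ hi ?_ (hadd _ _ (le_inf hh hu0) (le_inf hh hv0) h1 h2)
        have := add_inf_le_of_nonneg hu0 hv0 hh
        simpa [inf_comm] using this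
      -- Since h ≤ c and (n + 1)⁻¹ ≤ 2M/3, the element (n + 1)⁻¹h lies below both h and u + v, so h
      -- is at most n + 1 times a negligible element.
      refine hN (hmono _ _ hh ?_ (hNn hi h3 n))
      rw [← Nat.cast_smul_eq_nsmul ℝ]
      have hp : (0 : ℝ) < ((n + 1 : ℕ) : ℝ) := by positivity
      rw [← inv_smul_le_iff_of_pos hp]
      refine le_inf ?_ ?_
      · refine (smul_le_smul_of_nonneg_right (inv_le_one_of_one_le₀ ?_) hh).trans (one_smul ℝ h).le
        push_cast; linarith [(Nat.cast_nonneg n : (0 : ℝ) ≤ n)]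
      · refine le_trans ?_ huv
        refine (smul_le_smul_of_nonneg_left hhc (inv_nonneg.mpr hp.le)).trans
          (smul_le_smul_of_nonneg_right ?_ (hh.trans hhc))
        rw [inv_le_comm₀ hp (by positivity)]
        push_cast; linarith
    · have hi : 0 ≤ h ⊓ v := le_inf hh hv0
      refine ⟨_, hi, inf_le_left, h2, r - M / 3, ?_, ?_⟩
      · have := (NonposOn.posPart_neg ((r + M / 3) • c - x)).anti hi inf_le_right
        convert this using 1; module
      · convert (hx.anti hi inf_le_left).2 using 1; module
  · have hi : 0 ≤ h ⊓ u := le_inf hh hu0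
    refine ⟨_, hi, inf_le_left, h1, r + M / 3, ?_, ?_⟩
    · convert (hx.anti hi inf_le_left).1 using 1; module
    · have := (NonposOn.posPart_neg (x - (r - M / 3) • c)).anti hi inf_le_right
      convert this using 1; module

/-- If the negligible elements `N` form an ideal, then every `x` that is bounded by a multiple
of `c` on a non-negligible `h` is almost a multiple of `c` on some non-negligible `h' ≤ h`. -/
theorem exists_approxOn {N : G → Prop} (hmono : ∀ h h', 0 ≤ h' → h' ≤ h → N h → N h')
    (hadd : ∀ h h', 0 ≤ h → 0 ≤ h' → N h → N h' → N (h + h')) {c h x : G} (hh : 0 ≤ h) (hhc : h ≤ c)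
    (hN : ¬ N h) {M r : ℝ} (hx : ApproxOn c h M x r) {ε : ℝ} (hε : 0 < ε) :
    ∃ h', 0 ≤ h' ∧ h' ≤ h ∧ ¬ N h' ∧ ∃ s, ApproxOn c h' ε x s := by
  have hc := hh.trans hhc
  have key : ∀ n : ℕ, ∃ h', 0 ≤ h' ∧ h' ≤ h ∧ ¬ N h' ∧
      ∃ s, ApproxOn c h' ((2 / 3) ^ n * (|M| + 1)) x s := by
    -- The starting error is |M| + 1 because the bisection step requires a strictly positive error.
    intro n
    induction n with
    | zero => exact ⟨h, hh, le_rfl, hN, r, hx.mono hc hh (by simp; linarith [le_abs_self M])⟩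
    | succ n ih =>
      obtain ⟨h', h0, h1, h2, s, h3⟩ := ih
      obtain ⟨k, k0, k1, k2, t, k3⟩ :=
        exists_approxOn_step hmono hadd h0 (h1.trans hhc) h2 (by positivity) h3
      refine ⟨k, k0, k1.trans h1, k2, t, ?_⟩
      convert k3 using 1; ring
  obtain ⟨n, hn⟩ := exists_pow_lt_of_lt_one (show 0 < ε / (|M| + 1) by positivity)
    (show (2 / 3 : ℝ) < 1 by norm_num)
  obtain ⟨h', h0, h1, h2, s, h3⟩ := key n
  exact ⟨h', h0, h1, h2, s, h3.mono hc h0 ((lt_div_iff₀ (by positivity)).mp hn).le⟩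

end LocalOrder

/-! ### Representation of Archimedean Riesz spaces by germs of real functions -/

section Representation

variable {G : Type u} [AddCommGroup G] [Module ℝ G] [Lattice G] [IsOrderedAddMonoid G]
  [IsOrderedModule ℝ G]

theorem ApproxOn.recenter {c h z : G} {ε δ r s : ℝ} (hc : 0 ≤ c) (hh : 0 ≤ h)
    (H : ApproxOn c h ε z r) (hrs : |r - s| ≤ δ) : ApproxOn c h (ε + δ) z s := by
  have h1 : 0 ≤ ((s + (ε + δ)) - (r + ε)) • c :=
    smul_nonneg (by linarith [(abs_le.mp hrs).2]) hc
  have h2 : 0 ≤ ((r - ε) - (s - (ε + δ))) • c :=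
    smul_nonneg (by linarith [(abs_le.mp hrs).1]) hc
  refine ⟨H.1.mono hh ?_, H.2.mono hh ?_⟩ <;> rw [← sub_nonneg]
  · convert h1 using 1; module
  · convert h2 using 1; module

/-- In an Archimedean Riesz space, every element is bounded by a multiple of `p` on a nonzero part
of any nonzero `h ≤ p`. -/
theorem exists_approxOn_zero [IsArchimedeanRiesz G] {p h : G} (hh : 0 < h) (hhp : h ≤ p) (x : G) :
    ∃ h', 0 < h' ∧ h' ≤ h ∧ ∃ M : ℝ, ApproxOn p h' M x 0 := by
  by_contra! H
  refine hh.not_ge (IsArchimedeanRiesz.nonpos_of_nsmul_le h |x| fun n => ?_)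
  -- Where np exceeds |x|, the element x is bounded by np. If no nonzero part of h admits such a
  -- bound, then np ≤ |x| on all of h, whence nh ≤ |x| for every n.
  have h0 : NonposOn h ((n : ℝ) • p - |x|) := by
    have h1 : 0 ≤ h ⊓ ((n : ℝ) • p - |x|)⁺ := le_inf hh.le (posPart_nonneg _)
    by_contra h2
    rw [NonposOn, inf_comm] at h2
    have h3 := (NonposOn.posPart_neg ((n : ℝ) • p - |x|)).anti h1 inf_le_right
    refine H _ (lt_of_le_of_ne h1 (Ne.symm h2)) inf_le_left n ⟨h3.mono h1 ?_, h3.mono h1 ?_⟩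
    · rw [neg_sub, zero_add]
      exact sub_le_sub_right (le_abs_self x) _
    · rw [neg_sub, zero_sub, neg_smul, sub_eq_add_neg, sub_eq_add_neg, add_comm]
      exact add_le_add_left (neg_le_abs x) _
  have h4 : (n : ℝ) • h - |x| ≤ (n : ℝ) • h := sub_le_self _ (abs_nonneg x)
  have h5 := (h0.mono hh.le (sub_le_sub_right
    (smul_le_smul_of_nonneg_left hhp n.cast_nonneg) _)).nonpos hh.le n.cast_nonneg h4
  rw [sub_nonpos, Nat.cast_smul_eq_nsmul] at h5
  exact h5

/-- `φ x` is the value of `x / p` at a common point of a decreasing sequence of parts of `p`, for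
all `x ∈ D`. -/
def IsPointValue (p : G) (D : Set G) (φ : G → ℝ) : Prop :=
  ∃ h : ℕ → G, Antitone h ∧ (∀ n, 0 < h n ∧ h n ≤ p) ∧
    ∀ x ∈ D, ∀ ε > 0, ∃ n, ApproxOn p (h n) ε x (φ x)

theorem IsPointValue.mono {p : G} {D D' : Set G} {φ : G → ℝ} (H : IsPointValue p D φ)
    (hD : D' ⊆ D) : IsPointValue p D' φ := by
  obtain ⟨h, h1, h2, h3⟩ := H
  exact ⟨h, h1, h2, fun x hx => h3 x (hD hx)⟩

theorem exists_isPointValue [IsArchimedeanRiesz G] {p : G} (hp : 0 < p) {D : Set G}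
    (hD : D.Countable) : ∃ φ, IsPointValue p D φ := by
  have := hD.toEncodable
  -- A Rasiowa–Sikorski argument: among the nonzero parts of p, ordered downwards, those on which a
  -- given x is constant up to 1/(m + 1) are cofinal. One decreasing sequence meets these sets for
  -- all x in the countable D and all m.
  let P := {h : G // 0 < h ∧ h ≤ p}ᵒᵈ
  let C : D × ℕ → Order.Cofinal P := fun i =>
    { carrier := {h | ∃ r, ApproxOn p (OrderDual.ofDual h).1 (1 / ((i.2 : ℝ) + 1)) i.1.1 r}
      isCofinal := by
        intro h
        obtain ⟨h1, h1p, h1h, M, hM⟩ := exists_approxOn_zero (OrderDual.ofDual h).2.1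
          (OrderDual.ofDual h).2.2 i.1.1
        have h1p' := h1h.trans (OrderDual.ofDual h).2.2
        obtain ⟨h2, h20, h21, h2N, r, hr⟩ := exists_approxOn (N := fun x : G => x = 0)
          (fun a b hb hab ha => le_antisymm (hab.trans ha.le) hb)
          (fun a b _ _ ha hb => by rw [ha, hb, add_zero]) h1p.le h1p' h1p.ne' hM
          (show 0 < 1 / ((i.2 : ℝ) + 1) by positivity)
        exact ⟨OrderDual.toDual ⟨h2, lt_of_le_of_ne h20 (Ne.symm h2N), h21.trans h1p'⟩, ⟨r, hr⟩,
          h21.trans h1h⟩ }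
  let σ := Order.sequenceOfCofinals (OrderDual.toDual ⟨p, hp, le_rfl⟩ : P) C
  let h : ℕ → G := fun n => (OrderDual.ofDual (σ n)).1
  have hanti : Antitone h := fun m n hmn =>
    Order.sequenceOfCofinals.monotone (OrderDual.toDual ⟨p, hp, le_rfl⟩ : P) C hmn
  have hpos : ∀ n, 0 < h n ∧ h n ≤ p := fun n => (OrderDual.ofDual (σ n)).2
  have happ : ∀ x ∈ D, ∀ ε > 0, ∃ n r, ApproxOn p (h n) ε x r := by
    intro x hx ε hε
    obtain ⟨m, hm⟩ := exists_nat_one_div_lt hε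
    obtain ⟨r, hr⟩ := Order.sequenceOfCofinals.encode_mem
      (OrderDual.toDual ⟨p, hp, le_rfl⟩ : P) C (⟨x, hx⟩, m)
    exact ⟨_, r, hr.mono hp.le (hpos _).1.le hm.le⟩
  -- The supremum of all lower estimates r − ε along the sequence. By almost uniqueness of
  -- approximate values, any upper estimate bounds it, so for x in D it is the limit of the
  -- approximate values.
  refine ⟨fun x => sSup {t | ∃ n ε r, ApproxOn p (h n) ε x r ∧ t = r - ε}, h, hanti, hpos, ?_⟩
  intro x hx ε hε
  obtain ⟨n, r, hr⟩ := happ x hx (ε / 2) (by positivity)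
  refine ⟨n, ?_⟩
  have hub : ∀ t ∈ {t | ∃ n ε r, ApproxOn p (h n) ε x r ∧ t = r - ε}, t ≤ r + ε / 2 := by
    rintro t ⟨m, δ, s, hs, rfl⟩
    have h1 := hr.anti (hpos (max n m)).1.le (hanti (le_max_left n m))
    have h2 := hs.anti (hpos (max n m)).1.le (hanti (le_max_right n m))
    have := abs_le.mp (h1.abs_sub_le (hpos _).1 (hpos _).2 h2)
    linarith [this.1]
  have hmem : r - ε / 2 ∈ {t | ∃ n ε r, ApproxOn p (h n) ε x r ∧ t = r - ε} := ⟨n, _, r, hr, rfl⟩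
  have := hr.recenter hp.le (hpos n).1.le (s := sSup {t | ∃ n ε r, ApproxOn p (h n) ε x r ∧ t = r - ε})
    (δ := ε / 2) (abs_le.mpr ⟨by linarith [csSup_le ⟨_, hmem⟩ hub],
      by linarith [le_csSup ⟨_, hub⟩ hmem]⟩)
  rwa [add_halves] at this

/-- The parts decrease, so three approximations persist on the latest of the three parts. Algebraic
identities for φ then follow from the `ApproxOn` calculus and almost uniqueness. -/
theorem IsPointValue.exists_common {p : G} {x y z : G} {φ : G → ℝ}
    (H : IsPointValue p {x, y, z} φ) {ε : ℝ} (hε : 0 < ε) : ∃ h, 0 < h ∧ h ≤ p ∧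
      ApproxOn p h ε x (φ x) ∧ ApproxOn p h ε y (φ y) ∧ ApproxOn p h ε z (φ z) := by
  obtain ⟨h, hanti, hpos, happ⟩ := H
  obtain ⟨i, hi⟩ := happ x (by simp) ε hε
  obtain ⟨j, hj⟩ := happ y (by simp) ε hε
  obtain ⟨k, hk⟩ := happ z (by simp) ε hε
  have h0 := hpos (max i (max j k))
  exact ⟨_, h0.1, h0.2, hi.anti h0.1.le (hanti (by simp)), hj.anti h0.1.le (hanti (by simp)),
    hk.anti h0.1.le (hanti (by simp))⟩

theorem eq_of_forall_abs_sub_le {a b K : ℝ} (h : ∀ ε > 0, |a - b| ≤ K * ε) : a = b := by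
  rw [← sub_eq_zero, ← abs_eq_zero]
  refine le_antisymm (le_of_forall_pos_le_add fun δ hδ => ?_) (abs_nonneg _)
  have h1 := h (δ / (|K| + 1)) (by positivity)
  have h2 : K * (δ / (|K| + 1)) ≤ δ := by
    rw [mul_div_assoc', div_le_iff₀ (by positivity)]
    nlinarith [le_abs_self K]
  linarith

theorem IsPointValue.map_add {p x y : G} {φ : G → ℝ} (H : IsPointValue p {x, y, x + y} φ) :
    φ (x + y) = φ x + φ y := by
  refine eq_of_forall_abs_sub_le (K := 3) fun ε hε => ?_
  obtain ⟨h, h0, hp, hx, hy, hz⟩ := H.exists_common hε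
  have := hz.abs_sub_le h0 hp (hx.add h0.le hy)
  linarith

theorem IsPointValue.map_smul {p x : G} {t : ℝ} {φ : G → ℝ}
    (H : IsPointValue p {x, x, t • x} φ) : φ (t • x) = t * φ x := by
  refine eq_of_forall_abs_sub_le (K := 1 + |t|) fun ε hε => ?_
  obtain ⟨h, h0, hp, hx, hy, hz⟩ := H.exists_common hε
  have := hz.abs_sub_le h0 hp (hx.smul h0.le t)
  linarith

theorem IsPointValue.map_sup {p x y : G} {φ : G → ℝ} (H : IsPointValue p {x, y, x ⊔ y} φ) :
    φ (x ⊔ y) = φ x ⊔ φ y := by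
  refine eq_of_forall_abs_sub_le (K := 2) fun ε hε => ?_
  obtain ⟨h, h0, hp, hx, hy, hz⟩ := H.exists_common hε
  have := hz.abs_sub_le h0 hp (hx.sup (h0.le.trans hp) h0.le hy)
  linarith

theorem IsPointValue.map_inf {p x y : G} {φ : G → ℝ} (H : IsPointValue p {x, y, x ⊓ y} φ) :
    φ (x ⊓ y) = φ x ⊓ φ y := by
  refine eq_of_forall_abs_sub_le (K := 2) fun ε hε => ?_
  obtain ⟨h, h0, hp, hx, hy, hz⟩ := H.exists_common hε
  have := hz.abs_sub_le h0 hp (hx.inf (h0.le.trans hp) h0.le hy)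
  linarith

theorem IsPointValue.map_nonneg {p x : G} {φ : G → ℝ} (hx : 0 ≤ x)
    (H : IsPointValue p {x, 0, x ⊔ 0} φ) : 0 ≤ φ x := by
  have h0 : φ 0 = 0 := by
    have := IsPointValue.map_smul (t := 0) (x := 0) (H.mono (D' := {0, 0, (0 : ℝ) • (0 : G)}) (by simp))
    simpa using this
  have := H.map_sup
  rw [sup_eq_left.mpr hx, h0] at this
  rw [this]
  exact le_sup_right

theorem IsPointValue.map_unit {p : G} {φ : G → ℝ} (H : IsPointValue p {p} φ) : φ p = 1 := by
  refine eq_of_forall_abs_sub_le (K := 1) fun ε hε => ?_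
  obtain ⟨h, h0, hp, hx, -, -⟩ := IsPointValue.exists_common (x := p) (y := p) (z := p)
    (H.mono (by simp)) hε
  have := hx.abs_sub_le h0 hp (ApproxOn.self_unit h0.le)
  linarith

/-- The sets that contain all point values on some countable set. -/
def pointFilter (p : G) : Filter (G → ℝ) :=
  Filter.ofCountableInter {S | ∃ D : Set G, D.Countable ∧ ∀ φ, IsPointValue p D φ → φ ∈ S}
    (by
      intro T hT hTl
      choose D hDc hD using fun S : T => hTl S.2
      have := hT.to_subtype
      exact ⟨⋃ S, D S, Set.countable_iUnion hDc, fun φ hφ S hS =>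
        hD ⟨S, hS⟩ φ (hφ.mono (Set.subset_iUnion D ⟨S, hS⟩))⟩)
    (fun S T ⟨D, hDc, hD⟩ hST => ⟨D, hDc, fun φ hφ => hST (hD φ hφ)⟩)

instance (p : G) : CountableInterFilter (pointFilter p) := by
  unfold pointFilter
  infer_instance

theorem eventually_pointFilter {p : G} {P : (G → ℝ) → Prop} :
    (∀ᶠ φ in pointFilter p, P φ) ↔
      ∃ D : Set G, D.Countable ∧ ∀ φ, IsPointValue p D φ → P φ := Iff.rfl

end Representation

/-! ### Germs along a countably complete filter -/

section Germ

open Filter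

variable {X : Type u} {l : Filter X} {F : Type v} [AddCommGroup F] [Module ℝ F] [Lattice F]
  [IsOrderedAddMonoid F] [IsOrderedModule ℝ F]

instance : IsOrderedModule ℝ (Germ l F) where
  smul_le_smul_of_nonneg_left r hr a b h := by
    induction a, b using Germ.inductionOn₂ with | _ a b
    exact (show a ≤ᶠ[l] b from h).mono fun x hx => smul_le_smul_of_nonneg_left hx hr
  smul_le_smul_of_nonneg_right a ha r s h := by
    induction a using Germ.inductionOn with | _ a
    exact (show ∀ᶠ x in l, 0 ≤ a x from ha).mono fun x hx => smul_le_smul_of_nonneg_right h hx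

/-- Countable completeness lets the inequalities for all n hold simultaneously on one set of the
filter, where the Archimedean property of F applies pointwise. -/
instance [CountableInterFilter l] [IsArchimedeanRiesz F] : IsArchimedeanRiesz (Germ l F) where
  nonpos_of_nsmul_le a b h := by
    induction a, b using Germ.inductionOn₂ with | _ a b
    have h1 : ∀ᶠ x in l, ∀ n : ℕ, n • a x ≤ b x := eventually_countable_forall.mpr fun n => h n
    exact h1.mono fun x hx => IsArchimedeanRiesz.nonpos_of_nsmul_le _ _ hx

end Germ

/-! ### Nonvanishing of elementary tensors -/

section Nonzero

variable {E : Type u} {F : Type v}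
  [AddCommGroup E] [Module ℝ E] [Lattice E] [IsOrderedAddMonoid E] [IsOrderedModule ℝ E]
  [AddCommGroup F] [Module ℝ F] [Lattice F] [IsOrderedAddMonoid F] [IsOrderedModule ℝ F]

theorem smul_sup_of_nonneg {r : ℝ} (hr : 0 ≤ r) (x y : F) : r • (x ⊔ y) = r • x ⊔ r • y := by
  rcases hr.eq_or_lt with rfl | hr
  · simp
  · exact (OrderIso.smulRight hr).map_sup x y

theorem smul_inf_of_nonneg {r : ℝ} (hr : 0 ≤ r) (x y : F) : r • (x ⊓ y) = r • x ⊓ r • y := by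
  rcases hr.eq_or_lt with rfl | hr
  · simp
  · exact (OrderIso.smulRight hr).map_inf x y

theorem sup_smul_of_nonneg (r s : ℝ) {y : F} (hy : 0 ≤ y) : (r ⊔ s) • y = r • y ⊔ s • y :=
  Monotone.map_sup (f := fun t : ℝ => t • y) (fun _ _ h => smul_le_smul_of_nonneg_right h hy) r s

theorem inf_smul_of_nonneg (r s : ℝ) {y : F} (hy : 0 ≤ y) : (r ⊓ s) • y = r • y ⊓ s • y :=
  Monotone.map_inf (f := fun t : ℝ => t • y) (fun _ _ h => smul_le_smul_of_nonneg_right h hy) r s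

variable (F) in
/-- The Riesz bimorphism that sends `(x, y)` to the germ of `φ ↦ φ x • y`. -/
noncomputable def germBimorphism (p : E) :
    RieszBimorphism E F (Filter.Germ (pointFilter p) F) where
  toLin := LinearMap.mk₂ ℝ (fun x y => ((fun φ => φ x • y : (E → ℝ) → F) : Filter.Germ _ F))
    (fun x x' y => Filter.Germ.coe_eq.mpr <| eventually_pointFilter.mpr
      ⟨{x, x', x + x'}, by simp, fun φ hφ => by simp [hφ.map_add, add_smul]⟩)
    (fun r x y => Filter.Germ.coe_eq.mpr <| eventually_pointFilter.mpr
      ⟨{x, x, r • x}, by simp, fun φ hφ => by simp [hφ.map_smul, mul_smul]⟩)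
    (fun x y y' => Filter.Germ.coe_eq.mpr <| .of_forall fun φ => by simp)
    (fun r x y => Filter.Germ.coe_eq.mpr <| .of_forall fun φ => by simp [smul_comm r])
  map_sup_left x x' y hy := Filter.Germ.coe_eq.mpr <| eventually_pointFilter.mpr
      ⟨{x, x', x ⊔ x'}, by simp, fun φ hφ => by simp [hφ.map_sup, sup_smul_of_nonneg _ _ hy]⟩
  map_inf_left x x' y hy := Filter.Germ.coe_eq.mpr <| eventually_pointFilter.mpr
      ⟨{x, x', x ⊓ x'}, by simp, fun φ hφ => by simp [hφ.map_inf, inf_smul_of_nonneg _ _ hy]⟩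
  map_sup_right x y y' hx := Filter.Germ.coe_eq.mpr <| eventually_pointFilter.mpr
      -- Knowing φ at 0 and at x ⊔ 0 as well is what makes φ x nonnegative, so that scaling by it
      -- preserves the lattice operations.
      ⟨{x, 0, x ⊔ 0}, by simp, fun φ hφ => smul_sup_of_nonneg (hφ.map_nonneg hx) y y'⟩
  map_inf_right x y y' hx := Filter.Germ.coe_eq.mpr <| eventually_pointFilter.mpr
      ⟨{x, 0, x ⊔ 0}, by simp, fun φ hφ => smul_inf_of_nonneg (hφ.map_nonneg hx) y y'⟩

/-- One target suffices, namely the germs built over the base element x itself. If the germ of φ ↦ φ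
x • y vanished, it would vanish at all point values on some countable set. Adding x to that set
gives a point value with φ x = 1, hence y = 0. -/
theorem tmul_ne_zero [IsArchimedeanRiesz E] [IsArchimedeanRiesz F] {x : E} {y : F} (hx : 0 < x)
    (hy : y ≠ 0) : (ExprQuotient.tmul x y : FremlinTensor E F) ≠ 0 := by
  intro h
  have h1 := congrArg (ExprQuotient.eval ⟨_, germBimorphism F x⟩ (Set.mem_univ _)) h
  rw [ExprQuotient.eval_tmul, ExprQuotient.eval_zero] at h1
  obtain ⟨D, hDc, hD⟩ := eventually_pointFilter.mp (Filter.Germ.coe_eq.mp h1)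
  obtain ⟨φ, hφ⟩ := exists_isPointValue hx (hDc.insert x)
  have h2 : φ x • y = 0 := hD φ (hφ.mono (Set.subset_insert _ _))
  rw [IsPointValue.map_unit (hφ.mono (by simp)), one_smul] at h2
  exact hy h2

end Nonzero

/-! ### Elementary tensors are order dense in the Fremlin tensor product -/

section Density

variable {E : Type u} {F : Type v} {H : Type w}
  [AddCommGroup E] [Module ℝ E] [Lattice E] [IsOrderedAddMonoid E] [IsOrderedModule ℝ E]
  [AddCommGroup F] [Module ℝ F] [Lattice F] [IsOrderedAddMonoid F] [IsOrderedModule ℝ F]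
  [AddCommGroup H] [Module ℝ H] [Lattice H] [IsOrderedAddMonoid H] [IsOrderedModule ℝ H]

namespace RieszBimorphism

variable (ψ : RieszBimorphism E F H)

theorem nonneg {x : E} {y : F} (hx : 0 ≤ x) (hy : 0 ≤ y) : 0 ≤ ψ.toLin x y := by
  have := ψ.map_sup_left x 0 y hy
  rw [sup_eq_left.mpr hx, map_zero, LinearMap.zero_apply] at this
  exact this ▸ le_sup_right

theorem mono {x x' : E} {y y' : F} (hx : 0 ≤ x) (hxx : x ≤ x') (hy : 0 ≤ y) (hyy : y ≤ y') :
    ψ.toLin x y ≤ ψ.toLin x' y' := by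
  have h1 := ψ.nonneg (sub_nonneg.mpr hxx) hy
  have h2 := ψ.nonneg (hx.trans hxx) (sub_nonneg.mpr hyy)
  rw [map_sub, LinearMap.sub_apply, sub_nonneg] at h1
  rw [map_sub, sub_nonneg] at h2
  exact h1.trans h2

theorem abs_le {x a : E} {y b : F} (hx : |x| ≤ a) (hy : |y| ≤ b) :
    |ψ.toLin x y| ≤ ψ.toLin a b := by
  -- Uses 2(a⊗b − x⊗y) = (a−x)⊗(b+y) + (a+x)⊗(b−y), with all four factors nonnegative.
  have key : ∀ {x : E}, |x| ≤ a → ψ.toLin x y ≤ ψ.toLin a b := by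
    intro x hx
    obtain ⟨hx1, hx2⟩ := abs_le'.mp hx
    obtain ⟨hy1, hy2⟩ := abs_le'.mp hy
    have h1 := ψ.nonneg (sub_nonneg.mpr hx1) (sub_nonneg.mpr hy2)
    have h2 := ψ.nonneg (sub_nonneg.mpr hx2) (sub_nonneg.mpr hy1)
    have h3 := smul_nonneg (show (0 : ℝ) ≤ 1 / 2 by norm_num) (add_nonneg h1 h2)
    rw [← sub_nonneg]
    convert h3 using 1
    simp only [map_sub, map_neg, LinearMap.sub_apply, LinearMap.neg_apply]
    module
  refine abs_le'.mpr ⟨key hx, ?_⟩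
  have := key (x := -x) (by rwa [abs_neg])
  simpa using this

/-- Disjointness passes through the bimorphism only with a common second factor, so y and k are both
enlarged to y + k. Then z⁺⊗(y+k) and h⊗(y+k) are disjoint because z⁺ and h are. -/
theorem nonposOn_left {h z : E} {k y : F} (hh : 0 ≤ h) (hk : 0 ≤ k) (hy : 0 ≤ y)
    (hz : NonposOn h z) : NonposOn (ψ.toLin h k) (ψ.toLin z y) := by
  have hyk : 0 ≤ y + k := add_nonneg hy hk
  refine inf_eq_zero_mono (posPart_nonneg _) (ψ.nonneg hh hk)
    (?_ : _ ≤ ψ.toLin z⁺ (y + k)) (?_ : _ ≤ ψ.toLin h (y + k)) ?_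
  · refine posPart_le_of_nonneg ?_ (ψ.nonneg (posPart_nonneg z) hyk)
    refine le_trans ?_ (ψ.mono (posPart_nonneg z) le_rfl hy (le_add_of_nonneg_right hk))
    have := ψ.nonneg (sub_nonneg.mpr (le_posPart z)) hy
    rwa [map_sub, LinearMap.sub_apply, sub_nonneg] at this
  · exact ψ.mono hh le_rfl hk (le_add_of_nonneg_left hy)
  · rw [← ψ.map_inf_left _ _ _ hyk, show z⁺ ⊓ h = 0 from hz, map_zero, LinearMap.zero_apply]

theorem nonposOn_right {h x : E} {k z : F} (hh : 0 ≤ h) (hk : 0 ≤ k) (hx : 0 ≤ x)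
    (hz : NonposOn k z) : NonposOn (ψ.toLin h k) (ψ.toLin x z) := by
  have hxh : 0 ≤ x + h := add_nonneg hx hh
  refine inf_eq_zero_mono (posPart_nonneg _) (ψ.nonneg hh hk)
    (?_ : _ ≤ ψ.toLin (x + h) z⁺) (?_ : _ ≤ ψ.toLin (x + h) k) ?_
  · refine posPart_le_of_nonneg ?_ (ψ.nonneg hxh (posPart_nonneg z))
    refine le_trans ?_ (ψ.mono hx (le_add_of_nonneg_right hh) (posPart_nonneg z) le_rfl)
    have := ψ.nonneg hx (sub_nonneg.mpr (le_posPart z))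
    rwa [map_sub, sub_nonneg] at this
  · exact ψ.mono hh (le_add_of_nonneg_left hx) hk le_rfl
  · rw [← ψ.map_inf_right _ _ _ hxh, show z⁺ ⊓ k = 0 from hz, map_zero]

theorem approxOn_left {a h z : E} {b k y : F} {ε : ℝ} (hh : 0 ≤ h) (hk : 0 ≤ k)
    (hy : |y| ≤ b) (hz : ApproxOn a h ε z 0) :
    ApproxOn (ψ.toLin a b) (ψ.toLin h k) ε (ψ.toLin z y) 0 := by
  -- As y may have either sign, the estimate is split over nonnegative factors: 2(z⊗y − ε a⊗b) =
  -- (z−εa)⊗(b+y) + (−εa−z)⊗(b−y).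
  have key : ∀ {z : E}, ApproxOn a h ε z 0 →
      NonposOn (ψ.toLin h k) (ψ.toLin z y - (0 + ε) • ψ.toLin a b) := by
    intro z hz
    obtain ⟨hy1, hy2⟩ := abs_le'.mp hy
    have h1 := ψ.nonposOn_left hh hk (sub_nonneg.mpr hy2) hz.1
    have h2 := ψ.nonposOn_left hh hk (sub_nonneg.mpr hy1) hz.2
    have hhk := ψ.nonneg hh hk
    convert (h1.add hhk h2).smul hhk (show (0 : ℝ) ≤ 1 / 2 by norm_num) using 1
    simp only [map_sub, map_neg, map_smul, LinearMap.sub_apply, LinearMap.smul_apply]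
    module
  refine ⟨key hz, ?_⟩
  have := hz.neg
  rw [neg_zero] at this
  convert key this using 1
  simp only [map_neg, LinearMap.neg_apply]
  module

theorem approxOn_right {a h : E} {b k y : F} {ε s : ℝ} (ha : 0 ≤ a) (hh : 0 ≤ h) (hk : 0 ≤ k)
    (hy : ApproxOn b k ε y s) : ApproxOn (ψ.toLin a b) (ψ.toLin h k) ε (ψ.toLin a y) s := by
  refine ⟨?_, ?_⟩
  · convert ψ.nonposOn_right hh hk ha hy.1 using 1
    simp only [map_sub, map_smul]
  · convert ψ.nonposOn_right hh hk ha hy.2 using 1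
    simp only [map_sub, map_smul]

theorem approxOn {a h x : E} {b k y : F} {ε δ r s : ℝ} (ha : 0 ≤ a) (hh : 0 ≤ h) (hk : 0 ≤ k)
    (hyb : |y| ≤ b) (hx : ApproxOn a h ε x r) (hy : ApproxOn b k δ y s) :
    ApproxOn (ψ.toLin a b) (ψ.toLin h k) (ε + |r| * δ) (ψ.toLin x y) (r * s) := by
  -- Decompose x⊗y = (x − ra)⊗y + r(a⊗y); the first term costs ε, the second |r|δ.
  have hz : ApproxOn a h ε (x - r • a) 0 := by
    refine ⟨?_, ?_⟩
    · convert hx.1 using 1; module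
    · convert hx.2 using 1; module
  convert (ψ.approxOn_left hh hk hyb hz).add (ψ.nonneg hh hk)
    ((ψ.approxOn_right ha hh hk hy).smul (ψ.nonneg hh hk) r) using 1
  · simp
  · ring

/-- For all large `a` and `b`, the element `g` is bounded by a multiple of `a ⊗ b`, and almost a
multiple of `a ⊗ b` on small rectangles `h ⊗ k` that meet a given `w`. -/
def IsApproximable (g : H) : Prop :=
  ∃ a₀ b₀, 0 ≤ a₀ ∧ 0 ≤ b₀ ∧ ∀ a b, a₀ ≤ a → b₀ ≤ b → (∃ M : ℝ, |g| ≤ M • ψ.toLin a b) ∧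
    ∀ w, 0 ≤ w → ∀ h k, 0 ≤ h → h ≤ a → 0 ≤ k → k ≤ b → ψ.toLin h k ⊓ w ≠ 0 → ∀ ε > 0,
      ∃ h' k', 0 ≤ h' ∧ h' ≤ h ∧ 0 ≤ k' ∧ k' ≤ k ∧ ψ.toLin h' k' ⊓ w ≠ 0 ∧
        ∃ r, ApproxOn (ψ.toLin a b) (ψ.toLin h' k') ε g r

theorem isApproximable_toLin (x : E) (y : F) : ψ.IsApproximable (ψ.toLin x y) := by
  refine ⟨|x|, |y|, abs_nonneg x, abs_nonneg y, fun a b hxa hyb =>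
    ⟨⟨1, by rw [one_smul]; exact ψ.abs_le hxa hyb⟩, ?_⟩⟩
  intro w hw h k hh hha hk hkb hN ε hε
  obtain ⟨h', h0, h1, h2, r, hr⟩ := exists_approxOn (N := fun h => ψ.toLin h k ⊓ w = 0)
    (fun h h' h0 h1 h2 => inf_eq_zero_mono (ψ.nonneg h0 hk) hw (ψ.mono h0 h1 hk le_rfl) le_rfl h2)
    (fun h h' h0 h1 h2 h3 => by
      rw [map_add, LinearMap.add_apply]
      exact add_inf_eq_zero (ψ.nonneg h0 hk) (ψ.nonneg h1 hk) hw h2 h3)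
    hh hha hN (ApproxOn.of_abs_le hh (M := 1) (by rwa [one_smul])) (half_pos hε)
  -- The second side is cut only after h' is fixed: the tolerance for y must absorb the factor |r|,
  -- which is known only now.
  obtain ⟨k', k0, k1, k2, s, hs⟩ := exists_approxOn (N := fun k => ψ.toLin h' k ⊓ w = 0)
    (fun k k' k0 k1 k2 => inf_eq_zero_mono (ψ.nonneg h0 k0) hw (ψ.mono h0 le_rfl k0 k1) le_rfl k2)
    (fun k k' k0 k1 k2 k3 => by
      rw [map_add]
      exact add_inf_eq_zero (ψ.nonneg h0 k0) (ψ.nonneg h0 k1) hw k2 k3)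
    hk hkb h2 (ApproxOn.of_abs_le hk (M := 1) (by rwa [one_smul]))
    (show 0 < ε / 2 / (|r| + 1) by positivity)
  refine ⟨h', k', h0, h1, k0, k1, k2, r * s, ?_⟩
  have ha := (abs_nonneg x).trans hxa
  refine (ψ.approxOn ha h0 k0 hyb hr hs).mono (ψ.nonneg ha ((abs_nonneg y).trans hyb))
    (ψ.nonneg h0 k0) ?_
  have : |r| * (ε / 2 / (|r| + 1)) ≤ ε / 2 := by
    rw [mul_div_assoc', div_le_iff₀ (by positivity)]
    nlinarith [abs_nonneg r]
  linarith

variable {ψ}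

theorem IsApproximable.smul {g : H} (hg : ψ.IsApproximable g) (t : ℝ) :
    ψ.IsApproximable (t • g) := by
  obtain ⟨a₀, b₀, ha₀, hb₀, hab⟩ := hg
  refine ⟨a₀, b₀, ha₀, hb₀, fun a b ha hb => ?_⟩
  obtain ⟨⟨M, hM⟩, happ⟩ := hab a b ha hb
  refine ⟨⟨|t| * M, ?_⟩, fun w hw h k hh hha hk hkb hN ε hε => ?_⟩
  · have h1 := smul_le_smul_of_nonneg_left hM (abs_nonneg t)
    rw [mul_smul]
    refine le_trans (abs_le'.mpr ?_) h1
    rcases le_total 0 t with ht | ht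
    · rw [abs_of_nonneg ht, ← smul_neg]
      exact ⟨smul_le_smul_of_nonneg_left (le_abs_self g) ht,
        smul_le_smul_of_nonneg_left (neg_le_abs g) ht⟩
    · rw [abs_of_nonpos ht, ← neg_smul]
      refine ⟨?_, smul_le_smul_of_nonneg_left (le_abs_self g) (neg_nonneg.mpr ht)⟩
      have := smul_le_smul_of_nonneg_left (neg_le_abs g) (neg_nonneg.mpr ht)
      rwa [neg_smul_neg] at this
  · obtain ⟨h', k', h0, h1, k0, k1, hN', r, hr⟩ :=
      happ w hw h k hh hha hk hkb hN (ε / (|t| + 1)) (by positivity)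
    refine ⟨h', k', h0, h1, k0, k1, hN', _, (hr.smul (ψ.nonneg h0 k0) t).mono
      (ψ.nonneg (ha₀.trans ha) (hb₀.trans hb)) (ψ.nonneg h0 k0) ?_⟩
    rw [mul_div_assoc', div_le_iff₀ (by positivity)]
    nlinarith [abs_nonneg t]

/-- This is why approximability is required for all large a and b: a common reference a⊗b exists.
The rectangle is shrunk for g and then, inside it, for g'; the first approximation survives, and
each rectangle still meets w. -/
theorem IsApproximable.binary {g g' g'' : H} (hg : ψ.IsApproximable g)
    (hg' : ψ.IsApproximable g') (hbound : |g''| ≤ |g| + |g'|)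
    (hop : ∀ {c h : H} {ε r s : ℝ}, 0 ≤ c → 0 ≤ h → 0 < ε → ApproxOn c h ε g r →
      ApproxOn c h ε g' s → ∃ t, ApproxOn c h (ε + ε) g'' t) : ψ.IsApproximable g'' := by
  obtain ⟨a₀, b₀, ha₀, hb₀, hab⟩ := hg
  obtain ⟨a₁, b₁, ha₁, hb₁, hab'⟩ := hg'
  refine ⟨a₀ ⊔ a₁, b₀ ⊔ b₁, ha₀.trans le_sup_left, hb₀.trans le_sup_left, fun a b ha hb => ?_⟩
  obtain ⟨⟨M, hM⟩, happ⟩ := hab a b (le_sup_left.trans ha) (le_sup_left.trans hb)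
  obtain ⟨⟨M', hM'⟩, happ'⟩ := hab' a b (le_sup_right.trans ha) (le_sup_right.trans hb)
  refine ⟨⟨M + M', ?_⟩, fun w hw h k hh hha hk hkb hN ε hε => ?_⟩
  · rw [add_smul]
    exact hbound.trans (add_le_add hM hM')
  · obtain ⟨h', k', h0, h1, k0, k1, hN', r, hr⟩ :=
      happ w hw h k hh hha hk hkb hN (ε / 2) (half_pos hε)
    obtain ⟨h'', k'', h0', h1', k0', k1', hN'', s, hs⟩ :=
      happ' w hw h' k' h0 (h1.trans hha) k0 (k1.trans hkb) hN' (ε / 2) (half_pos hε)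
    obtain ⟨t, ht⟩ := hop (ψ.nonneg (ha₀.trans (le_sup_left.trans ha))
      (hb₀.trans (le_sup_left.trans hb))) (ψ.nonneg h0' k0') (half_pos hε)
      (hr.anti (ψ.nonneg h0' k0') (ψ.mono h0' h1' k0' k1')) hs
    rw [add_halves] at ht
    exact ⟨h'', k'', h0', h1'.trans h1, k0', k1'.trans k1, hN'', t, ht⟩

theorem abs_sup_le_add (x y : H) : |x ⊔ y| ≤ |x| + |y| := by
  refine abs_le'.mpr ⟨sup_le ?_ ?_, ?_⟩
  · exact (le_abs_self x).trans (le_add_of_nonneg_right (abs_nonneg y))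
  · exact (le_abs_self y).trans (le_add_of_nonneg_left (abs_nonneg x))
  · exact ((neg_le_neg le_sup_left).trans (neg_le_abs x)).trans
      (le_add_of_nonneg_right (abs_nonneg y))

theorem abs_inf_le_add (x y : H) : |x ⊓ y| ≤ |x| + |y| := by
  rw [← abs_neg (x ⊓ y), neg_inf, ← abs_neg x, ← abs_neg y]
  exact abs_sup_le_add _ _

variable (ψ) in
theorem isApproximable_eval (t : LatticeExpr E F) : ψ.IsApproximable (t.eval ψ) := by
  induction t with
  | tmul x y => exact ψ.isApproximable_toLin x y
  | zero => simpa [LatticeExpr.eval] using ψ.isApproximable_toLin 0 0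
  | add s t hs ht => exact hs.binary ht (abs_add_le _ _) fun _ hh _ h1 h2 => ⟨_, h1.add hh h2⟩
  | neg t ht => simpa [LatticeExpr.eval] using ht.smul (-1)
  | smul r t ht => exact ht.smul r
  | sup s t hs ht => exact hs.binary ht (abs_sup_le_add _ _) fun hc hh hε h1 h2 =>
      ⟨_, (h1.sup hc hh h2).mono hc hh (by linarith)⟩
  | inf s t hs ht => exact hs.binary ht (abs_inf_le_add _ _) fun hc hh hε h1 h2 =>
      ⟨_, (h1.inf hc hh h2).mono hc hh (by linarith)⟩

/-- Where g exceeds 2ε a⊗b, choose a rectangle on which g is within ε of a constant r. Since the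
rectangle meets that region, r > ε, and g dominates r − ε times the rectangle. The Archimedean
property supplies an ε for which the region is nonempty. -/
theorem IsApproximable.exists_smul_toLin_le [IsArchimedeanRiesz H] {g : H}
    (hg : ψ.IsApproximable g) (hg0 : 0 < g) :
    ∃ h k, 0 ≤ h ∧ 0 ≤ k ∧ ψ.toLin h k ≠ 0 ∧ ∃ δ : ℝ, 0 < δ ∧ δ • ψ.toLin h k ≤ g := by
  obtain ⟨a, b, ha, hb, hab⟩ := hg
  obtain ⟨⟨M, hM⟩, happ⟩ := hab a b le_rfl le_rfl
  have hc := ψ.nonneg ha hb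
  set c := ψ.toLin a b with hcdef
  obtain ⟨n, hn⟩ : ∃ n : ℕ, ¬ n • g ≤ c := by
    by_contra! h
    exact hg0.not_ge (IsArchimedeanRiesz.nonpos_of_nsmul_le g c h)
  have hn0 : (0 : ℝ) < n := by
    rcases Nat.eq_zero_or_pos n with rfl | h
    · simp [hc] at hn
    · exact_mod_cast h
  set ε : ℝ := (n : ℝ)⁻¹ / 2 with hεdef
  have hε : 0 < ε := by positivity
  have hεn : ε + ε = (n : ℝ)⁻¹ := by rw [hεdef]; ring
  set w := (g - (ε + ε) • c)⁺ with hwdef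
  have hw0 : 0 ≤ w := posPart_nonneg _
  have hw : w ≠ 0 := by
    intro h
    rw [hwdef, posPart_eq_zero, sub_nonpos, hεn, le_inv_smul_iff_of_pos hn0,
      Nat.cast_smul_eq_nsmul] at h
    exact hn h
  -- The element w is bounded by a multiple of c, so it cannot be nonzero and disjoint from c. Hence
  -- a⊗b is an admissible starting rectangle.
  have hcw : c ⊓ w ≠ 0 := by
    intro h
    have h1 : NonposOn c w := by
      rw [NonposOn, posPart_of_nonneg hw0, inf_comm]
      exact h
    refine hw (le_antisymm (h1.nonpos hc (abs_nonneg M) ?_) hw0)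
    refine posPart_le_of_nonneg ((sub_le_self _ (smul_nonneg (by positivity) hc)).trans ?_)
      (smul_nonneg (abs_nonneg M) hc)
    exact ((le_abs_self g).trans hM).trans (smul_le_smul_of_nonneg_right (le_abs_self M) hc)
  obtain ⟨h, k, h0, h1, k0, k1, hN, r, hr⟩ := happ w hw0 a b ha le_rfl hb le_rfl hcw ε hε
  have hhk := ψ.nonneg h0 k0
  have hrε : ε < r := by
    by_contra! hle
    have h2 : NonposOn (ψ.toLin h k) (g - (ε + ε) • c) :=
      hr.1.mono hhk (sub_le_sub_left (smul_le_smul_of_nonneg_right (by linarith) hc) _)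
    rw [NonposOn, inf_comm] at h2
    exact hN h2
  refine ⟨h, k, h0, k0, ?_, r - ε, sub_pos.mpr hrε, ?_⟩
  · intro h2
    rw [h2] at hN
    exact hN (inf_eq_left.mpr hw0)
  -- The difference (r − ε)(h⊗k) − g is nonpositive on the band of h⊗k and bounded by a multiple of
  -- h⊗k, hence nonpositive everywhere.
  · have hle : (r - ε) • ψ.toLin h k ≤ (r - ε) • c :=
      smul_le_smul_of_nonneg_left (ψ.mono h0 h1 k0 k1) (sub_pos.mpr hrε).le
    exact sub_nonpos.mp ((hr.2.mono hhk (sub_le_sub_right hle g)).nonpos hhk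
      (sub_pos.mpr hrε).le (sub_le_self _ hg0.le))

end RieszBimorphism

/-- Below every positive element of the Fremlin tensor product there is a positive multiple of a
nonzero elementary tensor of positive elements. -/
theorem FremlinTensor.exists_smul_tmul_le {g : FremlinTensor E F} (hg : 0 < g) :
    ∃ (h : E) (k : F), 0 < h ∧ 0 < k ∧ ∃ δ : ℝ, 0 < δ ∧ δ • ExprQuotient.tmul h k ≤ g := by
  have happ : (ExprQuotient.bimorphism Set.univ).IsApproximable g := by
    induction g using ExprQuotient.ind with | _ t
    rw [← ExprQuotient.eval_bimorphism]
    exact RieszBimorphism.isApproximable_eval _ t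
  obtain ⟨h, k, h0, k0, hN, δ, hδ, hle⟩ := happ.exists_smul_toLin_le hg
  refine ⟨h, k, lt_of_le_of_ne h0 ?_, lt_of_le_of_ne k0 ?_, δ, hδ, hle⟩
  · rintro rfl
    exact hN (by rw [map_zero, LinearMap.zero_apply])
  · rintro rfl
    exact hN (map_zero _)

end Density

/-! ### Components of a weak order unit -/

section Components

variable {G : Type u} [AddCommGroup G] [Module ℝ G] [Lattice G] [IsOrderedAddMonoid G]
  [IsOrderedModule ℝ G]

/-- In a Dedekind complete Riesz space with weak order unit `e`, every strictly positive element
dominates a positive multiple of a nonzero component of `e`. -/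
theorem IsWeakOrderUnit.exists_isComponent_smul_le (hG : IsDedekindComplete G) {e : G}
    (he : IsWeakOrderUnit e) {h : G} (hh : 0 < h) :
    ∃ p, IsComponent e p ∧ 0 < p ∧ ∃ r : ℝ, 0 < r ∧ r • p ≤ h := by
  have := hG.isArchimedeanRiesz
  obtain ⟨n, hn⟩ : ∃ n : ℕ, ¬ n • h ≤ e := by
    by_contra! H
    exact hh.not_ge (IsArchimedeanRiesz.nonpos_of_nsmul_le h e H)
  have hn0 : (0 : ℝ) < n := by
    rcases Nat.eq_zero_or_pos n with rfl | h
    · simp [he.1] at hn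
    · exact_mod_cast h
  set v := ((n : ℝ) • h - e)⁺ with hvdef
  have hv0 : 0 ≤ v := posPart_nonneg _
  have hv : v ≠ 0 := by
    intro H
    rw [hvdef, posPart_eq_zero, sub_nonpos, Nat.cast_smul_eq_nsmul] at H
    exact hn H
  -- The supremum p of these elements is the projection of e onto the band of v, that is, onto the
  -- region where nh exceeds e. There e ≤ nh, so n⁻¹p ≤ h.
  let P : ℕ → G := fun m => m • v ⊓ e
  have hP0 : ∀ m, 0 ≤ P m := fun m => le_inf (nsmul_nonneg hv0 m) he.1
  obtain ⟨p, hp⟩ := hG (Set.range P) (Set.range_nonempty P)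
    ⟨e, by rintro _ ⟨m, rfl⟩; exact inf_le_right⟩
  have hPp : ∀ m, P m ≤ p := fun m => hp.1 ⟨m, rfl⟩
  have hpe : p ≤ e := hp.2 (by rintro _ ⟨m, rfl⟩; exact inf_le_right)
  have hp0 : 0 ≤ p := (hP0 0).trans (hPp 0)
  have hep : 0 ≤ e - p := sub_nonneg.mpr hpe
  have h1 : v ⊓ (e - p) = 0 := by
    refine le_antisymm ?_ (le_inf hv0 hep)
    -- Adding v ∧ (e−p) to m v ∧ e stays below (m+1) v ∧ e, so p + v ∧ (e−p) is still at most p.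
    have h2 : p ≤ p - v ⊓ (e - p) := hp.2 (by
      rintro _ ⟨m, rfl⟩
      rw [le_sub_iff_add_le]
      refine le_trans (le_inf ?_ ?_) (hPp (m + 1))
      · rw [succ_nsmul]
        exact add_le_add inf_le_left inf_le_left
      · exact (add_le_add (hPp m) inf_le_right).trans (add_sub_cancel p e).le)
    simpa using h2
  have h2 : ∀ m, P m ⊓ (e - p) = 0 := fun m =>
    inf_eq_zero_mono (hP0 m) hep inf_le_left le_rfl (nsmul_inf_eq_zero hv0 hep h1 m)
  have hcomp : (e - p) ⊓ p = 0 := by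
    -- Each m v ∧ e is disjoint from (e−p) ∧ p, so their sum is their supremum, which is at most p.
    -- Hence p + (e−p) ∧ p ≤ p.
    refine le_antisymm ?_ (le_inf hep hp0)
    have h3 : p ≤ p - (e - p) ⊓ p := hp.2 (by
      rintro _ ⟨m, rfl⟩
      rw [le_sub_iff_add_le]
      have h4 : P m ⊓ ((e - p) ⊓ p) = 0 :=
        inf_eq_zero_mono (hP0 m) (le_inf hep hp0) le_rfl inf_le_left (h2 m)
      rw [← inf_add_sup, h4, zero_add]
      exact sup_le (hPp m) inf_le_right)
    simpa using h3
  refine ⟨p, ⟨hp0, hpe, hcomp⟩, lt_of_le_of_ne hp0 ?_, (n : ℝ)⁻¹, inv_pos.mpr hn0, ?_⟩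
  · rintro rfl
    refine hv (he.2 v (le_antisymm ?_ (le_inf (abs_nonneg v) he.1)))
    rw [abs_of_nonneg hv0]
    simpa [P] using hPp 1
  · rw [inv_smul_le_iff_of_pos hn0]
    refine hp.2 ?_
    rintro _ ⟨m, rfl⟩
    have h3 : NonposOn v (e - (n : ℝ) • h) := by
      convert NonposOn.posPart_neg ((n : ℝ) • h - e) using 1
      rw [neg_sub]
    refine sub_nonpos.mp ((h3.mono hv0 (sub_le_sub_right inf_le_right _)).nonpos hv0
      (Nat.cast_nonneg m) ((sub_le_self _ (smul_nonneg hn0.le hh.le)).trans ?_))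
    rw [Nat.cast_smul_eq_nsmul]
    exact inf_le_left

/-- If a component `w` of `c` has a positive multiple below a component `u` of `c`, then
`w ≤ u`. -/
theorem IsComponent.le_of_smul_le {c u w : G} (hu : IsComponent c u) (hw : IsComponent c w) {r : ℝ}
    (hr : 0 < r) (h : r • w ≤ u) : w ≤ u := by
  have hcu : 0 ≤ c - u := sub_nonneg.mpr hu.2.1
  have h1 : (r • w) ⊓ (c - u) = 0 :=
    inf_eq_zero_mono (smul_nonneg hr.le hw.1) hcu h le_rfl (by rw [inf_comm]; exact hu.2.2)
  have h2 : (r⁻¹ • r • w) ⊓ (c - u) = 0 :=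
    smul_inf_eq_zero (smul_nonneg hr.le hw.1) hcu h1 (inv_nonneg.mpr hr.le)
  rw [smul_smul, inv_mul_cancel₀ hr.ne', one_smul] at h2
  -- Disjointness of w and c − u turns their sum into their supremum.
  have h3 : w + (c - u) ≤ c := by
    rw [← inf_add_sup, h2, zero_add]
    exact sup_le hw.2.1 (sub_le_self _ hu.1)
  rwa [← add_sub_assoc, sub_le_iff_le_add, add_comm c, add_le_add_iff_right] at h3

/-- If `S` is a set of components of `c` such that every strictly positive element dominates a
positive multiple of a nonzero element of `S`, then every component of `c` is the supremum of the
elements of `S` below it. -/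
theorem IsComponent.isLUB_of_dense {c u : G} (hu : IsComponent c u) {S : Set G}
    (hS : ∀ w ∈ S, IsComponent c w) (hS0 : 0 ∈ S)
    (hdense : ∀ A : G, 0 < A → ∃ w ∈ S, 0 < w ∧ ∃ r : ℝ, 0 < r ∧ r • w ≤ A) :
    IsLUB {w | w ∈ S ∧ w ≤ u} u := by
  refine ⟨fun w hw => hw.2, fun B hB => ?_⟩
  by_contra huB
  -- Nonnegativity of B keeps u − u∧B below u, so that the w found under it is below u.
  have hB0 : 0 ≤ B := hB ⟨hS0, hu.1⟩
  have hA : 0 < u - u ⊓ B := by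
    refine lt_of_le_of_ne (sub_nonneg.mpr inf_le_left) fun h => huB ?_
    rw [eq_comm, sub_eq_zero, eq_comm] at h
    exact inf_eq_left.mp h
  obtain ⟨w, hwS, hw0, r, hr, hrA⟩ := hdense _ hA
  have hwu : w ≤ u :=
    hu.le_of_smul_le (hS w hwS) hr (hrA.trans (sub_le_self _ (le_inf hu.1 hB0)))
  have hwB : w ≤ B := hB ⟨hwS, hwu⟩
  -- Now w ≤ u∧B, so rw ≤ u − u∧B ≤ c − w, which is disjoint from w. Thus w is disjoint from itself.
  have h1 : r • w ≤ c - w := hrA.trans (sub_le_sub hu.2.1 (le_inf hwu hwB))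
  have h2 : r • w ⊓ w = 0 :=
    inf_eq_zero_mono (smul_nonneg hr.le hw0.le) hw0.le h1 le_rfl (hS w hwS).2.2
  have h3 : (r⁻¹ • r • w) ⊓ w = 0 :=
    smul_inf_eq_zero (smul_nonneg hr.le hw0.le) hw0.le h2 (inv_nonneg.mpr hr.le)
  rw [smul_smul, inv_mul_cancel₀ hr.ne', one_smul, inf_idem] at h3
  exact hw0.ne' h3

theorem DedekindCompletion.exists_of_le {A : DedekindCompletion G} [IsArchimedeanRiesz G]
    (hA : 0 < A) : ∃ g : G, 0 < g ∧ of g ≤ A := by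
  obtain ⟨g, hg, hg0⟩ : ∃ g ∈ A.left, ¬ g ≤ 0 := by
    by_contra! h
    exact hA.not_ge (le_iff_left.mpr h)
  refine ⟨g⁺, lt_of_le_of_ne (posPart_nonneg g) fun h => hg0 (posPart_eq_zero.mp h.symm), ?_⟩
  rw [posPart_def, show of (g ⊔ 0) = of g ⊔ of 0 from ofHom.map_sup' g 0]
  exact sup_le (of_le_iff.mpr hg) hA.le

theorem DedekindCompletion.isComponent_of [IsArchimedeanRiesz G] {c w : G}
    (h : IsComponent c w) : IsComponent (of c) (of w) := by
  refine ⟨of_le_of.mpr h.1, of_le_of.mpr h.2.1, ?_⟩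
  have h1 : of (c - w) = of c - of w := ofHom.toLinearMap.map_sub c w
  have h2 : of ((c - w) ⊓ w) = of (c - w) ⊓ of w := ofHom.map_inf' (c - w) w
  rw [← h1, ← h2, h.2.2]
  rfl

end Components

/-! ### Tensors of components and the conclusion -/

theorem RieszBimorphism.isComponent {E : Type u} {F : Type v} {H : Type w}
    [AddCommGroup E] [Module ℝ E] [Lattice E] [IsOrderedAddMonoid E] [IsOrderedModule ℝ E]
    [AddCommGroup F] [Module ℝ F] [Lattice F] [IsOrderedAddMonoid F] [IsOrderedModule ℝ F]
    [AddCommGroup H] [Module ℝ H] [Lattice H] [IsOrderedAddMonoid H] [IsOrderedModule ℝ H]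
    (ψ : RieszBimorphism E F H) {e p : E} {f q : F} (hp : IsComponent e p)
    (hq : IsComponent f q) : IsComponent (ψ.toLin e f) (ψ.toLin p q) := by
  have hp1 : 0 ≤ e - p := sub_nonneg.mpr hp.2.1
  have hq1 : 0 ≤ f - q := sub_nonneg.mpr hq.2.1
  have hf := hq.1.trans hq.2.1
  refine ⟨ψ.nonneg hp.1 hq.1, ψ.mono hp.1 hp.2.1 hq.1 hq.2.1, ?_⟩
  have h1 : ψ.toLin e f - ψ.toLin p q = ψ.toLin (e - p) f + ψ.toLin p (f - q) := by
    simp only [map_sub, LinearMap.sub_apply]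
    abel
  -- The first summand is disjoint even from p⊗f, which dominates p⊗q; the second is disjoint from
  -- p⊗q directly.
  have h2 : ψ.toLin (e - p) f ⊓ ψ.toLin p f = 0 := by
    rw [← ψ.map_inf_left _ _ _ hf, hp.2.2, map_zero, LinearMap.zero_apply]
  have h3 : ψ.toLin p (f - q) ⊓ ψ.toLin p q = 0 := by
    rw [← ψ.map_inf_right _ _ _ hp.1, hq.2.2, map_zero]
  rw [h1]
  exact add_inf_eq_zero (ψ.nonneg hp1 hf) (ψ.nonneg hp.1 hq1) (ψ.nonneg hp.1 hq.1)
    (inf_eq_zero_mono (ψ.nonneg hp1 hf) (ψ.nonneg hp.1 hq.1) le_rfl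
      (ψ.mono hp.1 le_rfl hq.1 hq.2.1) h2) h3

theorem isComponent_dtmul {E : Type u} {F : Type v}
    [AddCommGroup E] [Module ℝ E] [Lattice E] [IsOrderedAddMonoid E] [IsOrderedModule ℝ E]
    [AddCommGroup F] [Module ℝ F] [Lattice F] [IsOrderedAddMonoid F] [IsOrderedModule ℝ F]
    {e p : E} {f q : F} (hp : IsComponent e p) (hq : IsComponent f q) :
    IsComponent (dtmul e f) (dtmul p q) :=
  DedekindCompletion.isComponent_of ((ExprQuotient.bimorphism Set.univ).isComponent hp hq)

theorem exists_smul_dtmul_le {E : Type u} {F : Type v}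
    [AddCommGroup E] [Module ℝ E] [Lattice E] [IsOrderedAddMonoid E] [IsOrderedModule ℝ E]
    [AddCommGroup F] [Module ℝ F] [Lattice F] [IsOrderedAddMonoid F] [IsOrderedModule ℝ F]
    (hE : IsDedekindComplete E) (hF : IsDedekindComplete F) {e : E} {f : F}
    (he : IsWeakOrderUnit e) (hf : IsWeakOrderUnit f) {A : DedekindTensor E F} (hA : 0 < A) :
    ∃ p q, IsComponent e p ∧ IsComponent f q ∧ 0 < dtmul p q ∧
      ∃ r : ℝ, 0 < r ∧ r • dtmul p q ≤ A := by
  have := hE.isArchimedeanRiesz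
  have := hF.isArchimedeanRiesz
  obtain ⟨g, hg, hgA⟩ := DedekindCompletion.exists_of_le hA
  obtain ⟨h, k, hh, hk, δ, hδ, hle⟩ := FremlinTensor.exists_smul_tmul_le hg
  obtain ⟨p, hp, hp0, r, hr, hrp⟩ := he.exists_isComponent_smul_le hE hh
  obtain ⟨q, hq, hq0, s, hs, hsq⟩ := hf.exists_isComponent_smul_le hF hk
  have hpq : 0 < (ExprQuotient.tmul p q : FremlinTensor E F) :=
    lt_of_le_of_ne ((ExprQuotient.bimorphism Set.univ).nonneg hp0.le hq0.le)
      (tmul_ne_zero hp0 hq0.ne').symm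
  refine ⟨p, q, hp, hq, lt_of_le_of_ne (DedekindCompletion.of_le_of.mpr hpq.le)
    fun h => hpq.ne (DedekindCompletion.of_injective h), δ * (r * s), by positivity, ?_⟩
  have h1 : (r * s) • (ExprQuotient.tmul p q : FremlinTensor E F) ≤ ExprQuotient.tmul h k := by
    have := (ExprQuotient.bimorphism (Set.univ : Set (BimorphismTarget E F))).mono
      (smul_nonneg hr.le hp0.le) hrp (smul_nonneg hs.le hq0.le) hsq
    rw [map_smul, map_smul, LinearMap.smul_apply, smul_smul, mul_comm] at this
    exact this
  have h2 : (δ * (r * s)) • (ExprQuotient.tmul p q : FremlinTensor E F) ≤ g := by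
    rw [mul_smul]
    exact (smul_le_smul_of_nonneg_left h1 hδ.le).trans hle
  have h3 : DedekindCompletion.of ((δ * (r * s)) • (ExprQuotient.tmul p q : FremlinTensor E F)) =
      (δ * (r * s)) • dtmul p q := DedekindCompletion.ofHom.toLinearMap.map_smul _ _
  rw [← h3]
  exact (DedekindCompletion.of_le_of.mpr h2).trans hgA

theorem theorem3p1
    {E : Type u} [AddCommGroup E] [Module ℝ E] [Lattice E] [IsOrderedAddMonoid E]
    [IsOrderedModule ℝ E]
    {F : Type v} [AddCommGroup F] [Module ℝ F] [Lattice F] [IsOrderedAddMonoid F]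
    [IsOrderedModule ℝ F]
    (hE : IsDedekindComplete E) (hF : IsDedekindComplete F)
    {e : E} {f : F} (he : IsWeakOrderUnit e) (hf : IsWeakOrderUnit f) :
    (∀ (p : E) (q : F), IsComponent e p → IsComponent f q →
      IsComponent (dtmul e f) (dtmul p q)) ∧
    (∀ u : DedekindTensor E F, IsComponent (dtmul e f) u →
      IsLUB {w : DedekindTensor E F | ∃ (p : E) (q : F),
        IsComponent e p ∧ IsComponent f q ∧ w = dtmul p q ∧ dtmul p q ≤ u} u) := by
  refine ⟨fun p q hp hq => isComponent_dtmul hp hq, fun u hu => ?_⟩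
  convert hu.isLUB_of_dense
    (S := {w | ∃ p q, IsComponent e p ∧ IsComponent f q ∧ w = dtmul p q}) ?_ ?_ ?_ using 1
  · ext w
    constructor
    · rintro ⟨p, q, hp, hq, rfl, hle⟩
      exact ⟨⟨p, q, hp, hq, rfl⟩, hle⟩
    · rintro ⟨⟨p, q, hp, hq, rfl⟩, hle⟩
      exact ⟨p, q, hp, hq, rfl, hle⟩
  · rintro _ ⟨p, q, hp, hq, rfl⟩
    exact isComponent_dtmul hp hq
  -- Zero belongs to the family as the tensor of the zero components.
  · refine ⟨0, 0, ⟨le_rfl, he.1, by simp [he.1]⟩, ⟨le_rfl, hf.1, by simp [hf.1]⟩, ?_⟩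
    exact congrArg DedekindCompletion.of
      (map_zero ((ExprQuotient.bimorphism Set.univ).toLin (0 : E))).symm
  · intro A hA
    obtain ⟨p, q, hp, hq, hpq, r, hr, hle⟩ := exists_smul_dtmul_le hE hF he hf hA
    exact ⟨_, ⟨p, q, hp, hq, rfl⟩, hpq, r, hr, hle⟩
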